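/- Let all quantum systems be finite-dimensional (with nonzero Hilbert space). A state is a positive semidefinite matrix of trace $1$, and a channel is a completely positive trace-preserving linear map between the matrix algebras of two such systems (input and output dimensions may differ). With $\log$ in base $2$, let $S(\rho)=-\mathrm{tr}\,\rho\log\rho$, and for $1\le\alpha\le\infty$ let $S_\alpha(\rho)=\frac{1}{1-\alpha}\log \mathrm{tr}\,\rho^\alpha$ for $1<\alpha<\infty$, $S_1=S$, $S_\infty(\rho)=-\log\|\rho\|_\infty$ (operator norm). For a channel $T$ put $S_{\min,\alpha}(T)=\inf_\rho S_\alpha(T(\rho))$, $H_T(\rho)=\inf \sum_k p_k S(T(\rho_k))$, where the infimum is over all finite ensembles of states with $\sum_k p_k\rho_k=\rho$ ($\{p_k\}$ a probability distribution), and $\chi(T)=\sup_\rho\,[S(T(\rho))-H_T(\rho)]$; in $S_{\min,\alpha}$ and $\chi$, $\rho$ runs over all input states. Consider the following properties of a pair of channels $(T_1,T_2)$: 1. (for a given $\alpha\in[1,\infty]$) $S_{\min,\alpha}(T_1\otimes T_2)=S_{\min,\alpha}(T_1)+S_{\min,\alpha}(T_2)$; 2. $\chi(T_1\otimes T_2)=\chi(T_1)+\chi(T_2)$;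 3. $H_{T_1\otimes T_2}(\rho)\ge H_{T_1}(\rho_1)+H_{T_2}(\rho_2)$ for all states $\rho$ of the joint input system, where $\rho_1,\rho_2$ are the reduced states of $\rho$ on the two subsystems; 4. $H_{T_1\otimes T_2}(\rho_1\otimes\rho_2)=H_{T_1}(\rho_1)+H_{T_2}(\rho_2)$ for all input states $\rho_1$ of $T_1$ and $\rho_2$ of $T_2$. For each of these properties separately (and, in 1, for each fixed $\alpha\in[1,\infty]$), the property holds for all pairs of channels $(T_1,T_2)$ if and only if it holds for all pairs with $T_1=T_2$. -/

import Mathlib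

open scoped ENNReal Kronecker ComplexOrder

universe u

namespace QChannel

/-- Density matrices (states) of the system whose Hilbert space is `ℂ^A`. -/
abbrev DensityMatrix (A : Type u) [Fintype A] : Type u :=
  {ρ : Matrix A A ℂ // ρ.PosSemidef ∧ ρ.trace = 1}

/-- Complete positivity: for every `k`, applying `T` to each entry of a positive semidefinite
`k × k` block matrix gives a positive semidefinite block matrix. -/
def IsCompletelyPositive {A B : Type u} [Fintype A] [Fintype B]
    (T : Matrix A A ℂ →ₗ[ℂ] Matrix B B ℂ) : Prop :=
  ∀ (k : ℕ) (M : Matrix (Fin k) (Fin k) (Matrix A A ℂ)),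
    (Matrix.comp (Fin k) (Fin k) A A ℂ M).PosSemidef →
      (Matrix.comp (Fin k) (Fin k) B B ℂ (M.map T)).PosSemidef

/-- Quantum channels: completely positive trace preserving linear maps. -/
structure IsChannel {A B : Type u} [Fintype A] [Fintype B]
    (T : Matrix A A ℂ →ₗ[ℂ] Matrix B B ℂ) : Prop where
  completelyPositive : IsCompletelyPositive T
  trace_preserving : ∀ M : Matrix A A ℂ, (T M).trace = M.trace

/-- The tensor product `T₁ ⊗ T₂`, with `M_A ⊗ M_A'` identified with `M_{A × A'}` by the
Kronecker product. -/
noncomputable def tensor {A₁ B₁ A₂ B₂ : Type u} [Fintype A₁] [DecidableEq A₁]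
    [Fintype B₁] [DecidableEq B₁] [Fintype A₂] [DecidableEq A₂] [Fintype B₂] [DecidableEq B₂]
    (T₁ : Matrix A₁ A₁ ℂ →ₗ[ℂ] Matrix B₁ B₁ ℂ) (T₂ : Matrix A₂ A₂ ℂ →ₗ[ℂ] Matrix B₂ B₂ ℂ) :
    Matrix (A₁ × A₂) (A₁ × A₂) ℂ →ₗ[ℂ] Matrix (B₁ × B₂) (B₁ × B₂) ℂ :=
  (kroneckerLinearEquiv B₁ B₁ B₂ B₂ ℂ).toLinearMap ∘ₗ
    TensorProduct.map T₁ T₂ ∘ₗ (kroneckerLinearEquiv A₁ A₁ A₂ A₂ ℂ).symm.toLinearMap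

theorem tensor_kronecker {A₁ B₁ A₂ B₂ : Type u} [Fintype A₁] [DecidableEq A₁]
    [Fintype B₁] [DecidableEq B₁] [Fintype A₂] [DecidableEq A₂] [Fintype B₂] [DecidableEq B₂]
    (T₁ : Matrix A₁ A₁ ℂ →ₗ[ℂ] Matrix B₁ B₁ ℂ) (T₂ : Matrix A₂ A₂ ℂ →ₗ[ℂ] Matrix B₂ B₂ ℂ)
    (X : Matrix A₁ A₁ ℂ) (Y : Matrix A₂ A₂ ℂ) :
    tensor T₁ T₂ (X ⊗ₖ Y) = T₁ X ⊗ₖ T₂ Y := by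
  simp [tensor]

/-- The reduced state on the first subsystem: partial trace over the second one. -/
def reduced₁ {A₁ A₂ : Type u} [Fintype A₂] (ρ : Matrix (A₁ × A₂) (A₁ × A₂) ℂ) :
    Matrix A₁ A₁ ℂ :=
  Matrix.of fun i j => ∑ k, ρ (i, k) (j, k)

/-- The reduced state on the second subsystem: partial trace over the first one. -/
def reduced₂ {A₁ A₂ : Type u} [Fintype A₁] (ρ : Matrix (A₁ × A₂) (A₁ × A₂) ℂ) :
    Matrix A₂ A₂ ℂ :=
  Matrix.of fun i j => ∑ k, ρ (k, i) (k, j)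

/-- The von Neumann entropy `S(ρ) = - tr (ρ log₂ ρ)`; the matrix function is given by the
continuous functional calculus, and `0 log₂ 0 = 0`. -/
noncomputable def vonNeumannEntropy {B : Type u} [Fintype B] [DecidableEq B]
    (ρ : Matrix B B ℂ) : ℝ :=
  (cfc (fun x : ℝ => -(x * Real.logb 2 x)) ρ).trace.re

/-- The `α`-Rényi entropy, for `0 < α ≤ ∞`: `(1 - α)⁻¹ log₂ tr (ρ ^ α)` for finite `α ≠ 1`, and
the limits for `α = 1` (von Neumann entropy) and `α = ∞` (`- log₂` of the operator norm). -/
noncomputable def renyiEntropy {B : Type u} [Fintype B] [DecidableEq B]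
    (α : ℝ≥0∞) (ρ : Matrix B B ℂ) : ℝ :=
  if α = 1 then vonNeumannEntropy ρ
  else if α = ∞ then -Real.logb 2 ‖Matrix.toEuclideanCLM (n := B) (𝕜 := ℂ) ρ‖
  else 1 / (1 - α.toReal) * Real.logb 2 (cfc (fun x : ℝ => x ^ α.toReal) ρ).trace.re

/-- The minimal output `α`-Rényi entropy of `T`: infimum over all input states. -/
noncomputable def minOutputEntropy {A B : Type u} [Fintype A] [Fintype B] [DecidableEq B]
    (α : ℝ≥0∞) (T : Matrix A A ℂ →ₗ[ℂ] Matrix B B ℂ) : ℝ :=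
  ⨅ ρ : DensityMatrix A, renyiEntropy α (T ρ.1)

/-- The convex closure of the output entropy, `H_T(ρ) = inf ∑ k, p k * S(T (σ k))` over all finite
ensembles of states with average `ρ`. -/
noncomputable def convexClosure {A B : Type u} [Fintype A] [Fintype B] [DecidableEq B]
    (T : Matrix A A ℂ →ₗ[ℂ] Matrix B B ℂ) (ρ : Matrix A A ℂ) : ℝ :=
  sInf {h : ℝ | ∃ (n : ℕ) (p : Fin n → ℝ) (σ : Fin n → DensityMatrix A),
    (∀ k, 0 ≤ p k) ∧ ∑ k, p k = 1 ∧ ∑ k, (p k : ℂ) • (σ k).1 = ρ ∧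
      h = ∑ k, p k * vonNeumannEntropy (T (σ k).1)}

/-- The HSW capacity `χ(T) = sup_ρ (S(T ρ) - H_T(ρ))`. -/
noncomputable def hswCapacity {A B : Type u} [Fintype A] [Fintype B] [DecidableEq B]
    (T : Matrix A A ℂ →ₗ[ℂ] Matrix B B ℂ) : ℝ :=
  ⨆ ρ : DensityMatrix A, (vonNeumannEntropy (T ρ.1) - convexClosure T ρ.1)

/-- Additivity of the minimal output `α`-Rényi entropy for the pair `T₁, T₂`. -/
def MinOutputEntropyAdditive (α : ℝ≥0∞) {A₁ B₁ A₂ B₂ : Type u}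
    [Fintype A₁] [DecidableEq A₁] [Fintype B₁] [DecidableEq B₁]
    [Fintype A₂] [DecidableEq A₂] [Fintype B₂] [DecidableEq B₂]
    (T₁ : Matrix A₁ A₁ ℂ →ₗ[ℂ] Matrix B₁ B₁ ℂ) (T₂ : Matrix A₂ A₂ ℂ →ₗ[ℂ] Matrix B₂ B₂ ℂ) :
    Prop :=
  minOutputEntropy α (tensor T₁ T₂) = minOutputEntropy α T₁ + minOutputEntropy α T₂

/-- Additivity of the HSW capacity for the pair `T₁, T₂`. -/
def HSWCapacityAdditive {A₁ B₁ A₂ B₂ : Type u}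
    [Fintype A₁] [DecidableEq A₁] [Fintype B₁] [DecidableEq B₁]
    [Fintype A₂] [DecidableEq A₂] [Fintype B₂] [DecidableEq B₂]
    (T₁ : Matrix A₁ A₁ ℂ →ₗ[ℂ] Matrix B₁ B₁ ℂ) (T₂ : Matrix A₂ A₂ ℂ →ₗ[ℂ] Matrix B₂ B₂ ℂ) :
    Prop :=
  hswCapacity (tensor T₁ T₂) = hswCapacity T₁ + hswCapacity T₂

/-- Strong superadditivity of the convex closure of the output entropy for the pair `T₁, T₂`. -/
def ConvexClosureStronglySuperadditive {A₁ B₁ A₂ B₂ : Type u}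
    [Fintype A₁] [DecidableEq A₁] [Fintype B₁] [DecidableEq B₁]
    [Fintype A₂] [DecidableEq A₂] [Fintype B₂] [DecidableEq B₂]
    (T₁ : Matrix A₁ A₁ ℂ →ₗ[ℂ] Matrix B₁ B₁ ℂ) (T₂ : Matrix A₂ A₂ ℂ →ₗ[ℂ] Matrix B₂ B₂ ℂ) :
    Prop :=
  ∀ ρ : DensityMatrix (A₁ × A₂),
    convexClosure (tensor T₁ T₂) ρ.1 ≥
      convexClosure T₁ (reduced₁ ρ.1) + convexClosure T₂ (reduced₂ ρ.1)

/-- Additivity of the convex closure of the output entropy on product states for the pair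
`T₁, T₂`. -/
def ConvexClosureAdditiveOnProducts {A₁ B₁ A₂ B₂ : Type u}
    [Fintype A₁] [DecidableEq A₁] [Fintype B₁] [DecidableEq B₁]
    [Fintype A₂] [DecidableEq A₂] [Fintype B₂] [DecidableEq B₂]
    (T₁ : Matrix A₁ A₁ ℂ →ₗ[ℂ] Matrix B₁ B₁ ℂ) (T₂ : Matrix A₂ A₂ ℂ →ₗ[ℂ] Matrix B₂ B₂ ℂ) :
    Prop :=
  ∀ (ρ₁ : DensityMatrix A₁) (ρ₂ : DensityMatrix A₂),
    convexClosure (tensor T₁ T₂) (ρ₁.1 ⊗ₖ ρ₂.1) = convexClosure T₁ ρ₁.1 + convexClosure T₂ ρ₂.1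

/-- `P` holds for all pairs of channels between finite-dimensional (nonzero) systems. -/
def ForAllPairs
    (P : ∀ {A₁ B₁ A₂ B₂ : Type u} [Fintype A₁] [DecidableEq A₁] [Fintype B₁] [DecidableEq B₁]
      [Fintype A₂] [DecidableEq A₂] [Fintype B₂] [DecidableEq B₂],
      (Matrix A₁ A₁ ℂ →ₗ[ℂ] Matrix B₁ B₁ ℂ) → (Matrix A₂ A₂ ℂ →ₗ[ℂ] Matrix B₂ B₂ ℂ) → Prop) :
    Prop :=
  ∀ (A₁ B₁ A₂ B₂ : Type u) [Fintype A₁] [DecidableEq A₁] [Nonempty A₁]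
    [Fintype B₁] [DecidableEq B₁] [Fintype A₂] [DecidableEq A₂] [Nonempty A₂]
    [Fintype B₂] [DecidableEq B₂]
    (T₁ : Matrix A₁ A₁ ℂ →ₗ[ℂ] Matrix B₁ B₁ ℂ) (T₂ : Matrix A₂ A₂ ℂ →ₗ[ℂ] Matrix B₂ B₂ ℂ),
    IsChannel T₁ → IsChannel T₂ → P T₁ T₂

/-- `P` holds for all pairs of equal channels between finite-dimensional (nonzero) systems. -/
def ForAllEqualPairs
    (P : ∀ {A₁ B₁ A₂ B₂ : Type u} [Fintype A₁] [DecidableEq A₁] [Fintype B₁] [DecidableEq B₁]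
      [Fintype A₂] [DecidableEq A₂] [Fintype B₂] [DecidableEq B₂],
      (Matrix A₁ A₁ ℂ →ₗ[ℂ] Matrix B₁ B₁ ℂ) → (Matrix A₂ A₂ ℂ →ₗ[ℂ] Matrix B₂ B₂ ℂ) → Prop) :
    Prop :=
  ∀ (A B : Type u) [Fintype A] [DecidableEq A] [Nonempty A] [Fintype B] [DecidableEq B]
    (T : Matrix A A ℂ →ₗ[ℂ] Matrix B B ℂ), IsChannel T → P T T

end QChannel

/-!
If `T = T₁ ⊕ T₂` is the direct sum of two channels, acting on the diagonal blocks of its input and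
writing to orthogonal output blocks, then `T ⊗ T` is the direct sum of the four channels `Tᵢ ⊗ Tⱼ`
(`IsDirectSum.tensor`). Each property for the equal pair `(T, T)` therefore contains information about
the block `T₁ ⊗ T₂`.

* For the convex closure this is immediate: an ensemble whose average lives on one block consists of
  states of that block, so `H_T` and `H_{T ⊗ T}` restrict to `H_{Tᵢ}` and `H_{Tᵢ ⊗ Tⱼ}`
  (`convexClosure_conjLin`).
* For the capacity, `2 ^ χ(⨁ᵢ Sᵢ) = ∑ᵢ 2 ^ χ(Sᵢ)` (`IsDirectSum.hswCapacity_le` and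
  `IsDirectSum.le_hswCapacity`, by the Gibbs variational principle). Additivity for `(T, T)` hence says
  `∑ᵢⱼ 2 ^ χ(Tᵢ ⊗ Tⱼ) = ∑ᵢⱼ 2 ^ (χ(Tᵢ) + χ(Tⱼ))`, and as every term on the left is at least the
  corresponding one on the right (`hswCapacity_add_le_tensor`), all terms agree.
* The minimal output entropy of a direct sum is the minimum over the summands, so the two channels are
  first adjusted to nearly equal minimal output entropy. With `sᵢ` the minimal output entropy of `Tᵢ`
  and `τᵢ` an output state of `Tᵢ` of entropy at most `sᵢ + ε / 2`, put `T₁' = T₁ ⊗ τ₂` and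
  `T₂' = T₂ ⊗ τ₁`. Their direct sum `T` has minimal output entropy at least `s₁ + s₂`, so additivity
  for `(T, T)` bounds that of `T₁' ⊗ T₂'` below by `2 (s₁ + s₂)`; it is at most that of `T₁ ⊗ T₂` plus
  `s₁ + s₂ + ε`. No continuity or attainment of infima is needed.

All entropies are computed from spectral decompositions along rectangular isometries (`SpecDecomp`),
which embed, tensor and add up without any bookkeeping of zero eigenvalues.
-/

namespace QChannel

open Matrix

/-! ### Spectral decompositions -/

/-- A spectral decomposition `M = V diag(d) Vᴴ` with real `d`. The matrix `V` is only required to be an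
isometry and may be rectangular, so that `d` may omit eigenvalues `0` of `M`; in this form the notion
is stable under isometric embeddings and orthogonal sums. -/
structure SpecDecomp {B C : Type*} [Fintype B] [Fintype C] [DecidableEq C]
    (M : Matrix B B ℂ) (V : Matrix B C ℂ) (d : C → ℝ) : Prop where
  isometry : Vᴴ * V = 1
  eq_conj : M = V * diagonal (fun c => (d c : ℂ)) * Vᴴ

namespace SpecDecomp

section
variable {B C : Type*} [Fintype B] [Fintype C] [DecidableEq C]
  {M : Matrix B B ℂ} {V : Matrix B C ℂ} {d : C → ℝ}

theorem isHermitian (h : SpecDecomp M V d) : M.IsHermitian := by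
  rw [h.eq_conj, IsHermitian]
  simp [Matrix.mul_assoc, Pi.star_def]

theorem diagonal_eq (h : SpecDecomp M V d) : diagonal (fun c => (d c : ℂ)) = Vᴴ * M * V := by
  have h1 := h.isometry
  rw [h.eq_conj]
  calc _ = (Vᴴ * V) * diagonal (fun c => (d c : ℂ)) * (Vᴴ * V) := by rw [h1]; simp
    _ = _ := by simp only [Matrix.mul_assoc]

theorem trace_eq (h : SpecDecomp M V d) : M.trace = ((∑ c, d c : ℝ) : ℂ) := by
  rw [h.eq_conj, Matrix.mul_assoc, trace_mul_comm, Matrix.mul_assoc, h.isometry]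
  simp [trace_diagonal]

theorem nonneg (h : SpecDecomp M V d) (hM : M.PosSemidef) (c : C) : 0 ≤ d c := by
  have h1 := hM.conjTranspose_mul_mul_same V
  rw [← h.diagonal_eq, posSemidef_diagonal_iff] at h1
  exact_mod_cast h1 c

theorem conj {B' : Type*} [Fintype B'] [DecidableEq B] {W : Matrix B' B ℂ} (hW : Wᴴ * W = 1)
    (h : SpecDecomp M V d) : SpecDecomp (W * M * Wᴴ) (W * V) d where
  isometry := by
    rw [conjTranspose_mul, Matrix.mul_assoc, ← Matrix.mul_assoc _ W, hW, Matrix.one_mul,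
      h.isometry]
  eq_conj := by
    rw [conjTranspose_mul]
    conv_lhs => rw [h.eq_conj]
    simp only [Matrix.mul_assoc]

theorem smul (h : SpecDecomp M V d) (t : ℝ) : SpecDecomp ((t : ℂ) • M) V (fun c => t * d c) where
  isometry := h.isometry
  eq_conj := by
    conv_lhs => rw [h.eq_conj]
    have : diagonal (fun c => ((t * d c : ℝ) : ℂ)) = (t : ℂ) • diagonal (fun c => (d c : ℂ)) := by
      rw [← diagonal_smul]; congr 1; ext c; simp
    rw [this]; simp

theorem kronecker {B' C' : Type*} [Fintype B'] [Fintype C'] [DecidableEq C']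
    {M' : Matrix B' B' ℂ} {V' : Matrix B' C' ℂ} {d' : C' → ℝ}
    (h : SpecDecomp M V d) (h' : SpecDecomp M' V' d') :
    SpecDecomp (M ⊗ₖ M') (V ⊗ₖ V') (fun c => d c.1 * d' c.2) where
  isometry := by
    rw [conjTranspose_kronecker, ← mul_kronecker_mul, h.isometry, h'.isometry, one_kronecker_one]
  eq_conj := by
    have : diagonal (fun c : C × C' => ((d c.1 * d' c.2 : ℝ) : ℂ)) =
        diagonal (fun c => (d c : ℂ)) ⊗ₖ diagonal (fun c => (d' c : ℂ)) := by
      rw [diagonal_kronecker_diagonal]; simp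
    rw [this, conjTranspose_kronecker, ← mul_kronecker_mul, ← mul_kronecker_mul, ← h.eq_conj,
      ← h'.eq_conj]

/-- Traces of the functional calculus can be read off any spectral decomposition once `f 0 = 0`: the
eigenvalues of `M` and the family `d` differ only by zeros. -/
theorem trace_cfc [DecidableEq B] (h : SpecDecomp M V d) {f : ℝ → ℝ} (hf : f 0 = 0) :
    (cfc f M).trace.re = ∑ c, f (d c) := by
  have hM := h.isHermitian
  have h1 : (cfc f M).trace.re = ∑ b, f (hM.eigenvalues b) := by
    rw [hM.cfc_eq, IsHermitian.cfc, Unitary.conjStarAlgAut_apply, trace_mul_comm,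
      ← Matrix.mul_assoc]
    simp [trace_diagonal]
  -- `V (D Vᴴ)` and `(D Vᴴ) V = D` have the same characteristic polynomial up to powers of `X`.
  have h2 := charpoly_mul_comm' V (diagonal (fun c => (d c : ℂ)) * Vᴴ)
  rw [← Matrix.mul_assoc, ← h.eq_conj, Matrix.mul_assoc, h.isometry, Matrix.mul_one] at h2
  have h3 := congrArg Polynomial.roots h2
  rw [Polynomial.roots_mul (mul_ne_zero (pow_ne_zero _ Polynomial.X_ne_zero)
      (charpoly_monic _).ne_zero), Polynomial.roots_mul (mul_ne_zero
      (pow_ne_zero _ Polynomial.X_ne_zero) (charpoly_monic _).ne_zero),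
    hM.roots_charpoly_eq_eigenvalues, charpoly_diagonal,
    Polynomial.roots_prod _ _ (Finset.prod_ne_zero_iff.2 fun i _ => Polynomial.X_sub_C_ne_zero _)]
    at h3
  have h4 := congrArg (fun s : Multiset ℂ => (s.map fun z => f z.re).sum) h3
  rw [h1]
  simpa [hf, Multiset.map_nsmul, Multiset.sum_nsmul, Multiset.bind_singleton, Function.comp_def] using h4

open scoped Matrix.Norms.L2Operator in
theorem norm_eq [DecidableEq B] (h : SpecDecomp M V d) :
    ‖Matrix.toEuclideanCLM (n := B) (𝕜 := ℂ) M‖ = ‖d‖ := by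
  rw [← cstar_norm_def]
  have hV : ‖V‖ ≤ 1 := by
    have h1 := l2_opNorm_conjTranspose_mul_self V
    rw [h.isometry] at h1
    have h2 : ‖(1 : Matrix C C ℂ)‖ ≤ 1 := by
      rw [← diagonal_one, l2_opNorm_diagonal]
      exact (pi_norm_le_iff_of_nonneg zero_le_one).2 (by simp)
    nlinarith [norm_nonneg V]
  have hV' : ‖Vᴴ‖ ≤ 1 := by rwa [l2_opNorm_conjTranspose]
  have hd : ‖diagonal (fun c => (d c : ℂ))‖ = ‖d‖ := by
    rw [l2_opNorm_diagonal]
    simp [Pi.norm_def]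
  apply le_antisymm
  · rw [h.eq_conj]
    calc _ ≤ ‖V‖ * ‖diagonal (fun c => (d c : ℂ))‖ * ‖Vᴴ‖ :=
          (l2_opNorm_mul _ _).trans (by gcongr; exact l2_opNorm_mul _ _)
      _ ≤ 1 * ‖d‖ * 1 := by rw [hd]; gcongr
      _ = _ := by ring
  · rw [← hd, h.diagonal_eq]
    calc _ ≤ ‖Vᴴ‖ * ‖M‖ * ‖V‖ :=
          (l2_opNorm_mul _ _).trans (by gcongr; exact l2_opNorm_mul _ _)
      _ ≤ 1 * ‖M‖ * 1 := by gcongr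
      _ = _ := by ring

end

/-- A spectral decomposition of `∑ i, W i * M i * (W i)ᴴ` for isometries `W i` with pairwise orthogonal
ranges, indexed by the disjoint union of the index sets. -/
theorem sum {ι : Type*} [Fintype ι] [DecidableEq ι] {B : Type*} [Fintype B] {B' C : ι → Type*}
    [∀ i, Fintype (B' i)] [∀ i, DecidableEq (B' i)] [∀ i, Fintype (C i)] [∀ i, DecidableEq (C i)]
    {W : ∀ i, Matrix B (B' i) ℂ} {M : ∀ i, Matrix (B' i) (B' i) ℂ}
    {V : ∀ i, Matrix (B' i) (C i) ℂ} {d : ∀ i, C i → ℝ}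
    (hW : ∀ i, (W i)ᴴ * W i = 1) (hW' : ∀ i j, i ≠ j → (W i)ᴴ * W j = 0)
    (h : ∀ i, SpecDecomp (M i) (V i) (d i)) :
    SpecDecomp (∑ i, W i * M i * (W i)ᴴ)
      (Matrix.of fun b (c : Σ i, C i) => (W c.1 * V c.1) b c.2) (fun c => d c.1 c.2) where
  isometry := by
    ext ⟨i, c⟩ ⟨j, c'⟩
    have h1 : ((of fun b (c : Σ i, C i) => (W c.1 * V c.1) b c.2)ᴴ *
        (of fun b (c : Σ i, C i) => (W c.1 * V c.1) b c.2)) ⟨i, c⟩ ⟨j, c'⟩ =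
        ((V i)ᴴ * ((W i)ᴴ * W j) * V j) c c' := by
      have h2 : (V i)ᴴ * ((W i)ᴴ * W j) * V j = (W i * V i)ᴴ * (W j * V j) := by
        simp only [conjTranspose_mul, Matrix.mul_assoc]
      rw [h2, Matrix.mul_apply, Matrix.mul_apply]
      rfl
    rw [h1]
    by_cases hij : i = j
    · subst hij
      rw [hW, Matrix.mul_one, (h i).isometry]
      simp [Matrix.one_apply]
    · rw [hW' i j hij]
      simp [hij]
  eq_conj := by
    ext b b'
    have h1 : ∀ i, W i * M i * (W i)ᴴ =
        (W i * V i) * diagonal (fun c => (d i c : ℂ)) * (W i * V i)ᴴ := fun i =>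
      ((h i).conj (hW i)).eq_conj
    rw [Matrix.sum_apply, Matrix.mul_apply, Fintype.sum_sigma]
    refine Finset.sum_congr rfl fun i _ => ?_
    rw [h1, Matrix.mul_apply]
    simp [Matrix.mul_diagonal]

end SpecDecomp

theorem exists_specDecomp {B : Type*} [Fintype B] [DecidableEq B] {M : Matrix B B ℂ}
    (hM : M.IsHermitian) : ∃ (V : Matrix B B ℂ) (d : B → ℝ), SpecDecomp M V d := by
  refine ⟨hM.eigenvectorUnitary, hM.eigenvalues, ?_, ?_⟩
  · exact Unitary.coe_star_mul_self _
  · conv_lhs => rw [hM.spectral_theorem, Unitary.conjStarAlgAut_apply]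
    rfl

/-! ### Isometric conjugations and positivity of tensor products -/

theorem kronecker_induction {A₁ A₂ : Type*} [Fintype A₁] [DecidableEq A₁] [Fintype A₂]
    [DecidableEq A₂] {P : Matrix (A₁ × A₂) (A₁ × A₂) ℂ → Prop}
    (add : ∀ M N, P M → P N → P (M + N))
    (kron : ∀ (X : Matrix A₁ A₁ ℂ) (Y : Matrix A₂ A₂ ℂ), P (X ⊗ₖ Y))
    (M : Matrix (A₁ × A₂) (A₁ × A₂) ℂ) : P M := by
  obtain ⟨t, rfl⟩ := (kroneckerLinearEquiv A₁ A₁ A₂ A₂ ℂ).surjective M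
  induction t using TensorProduct.induction_on with
  | zero =>
    have h := kron 0 0
    rwa [← kroneckerLinearEquiv_tmul, TensorProduct.zero_tmul] at h
  | tmul x y => exact kron x y
  | add x y hx hy => rw [map_add]; exact add _ _ hx hy

/-- The linear map `X ↦ V X Vᴴ`. -/
def conjLin {A B : Type*} [Fintype A] (V : Matrix B A ℂ) : Matrix A A ℂ →ₗ[ℂ] Matrix B B ℂ where
  toFun X := V * X * Vᴴ
  map_add' X Y := by rw [Matrix.mul_add, Matrix.add_mul]
  map_smul' c X := by simp

theorem conjLin_apply {A B : Type*} [Fintype A] (V : Matrix B A ℂ) (X : Matrix A A ℂ) :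
    conjLin V X = V * X * Vᴴ := rfl

theorem conjLin_kronecker {A₁ A₂ B₁ B₂ : Type*} [Fintype A₁] [Fintype A₂] (V : Matrix B₁ A₁ ℂ)
    (W : Matrix B₂ A₂ ℂ) (X : Matrix A₁ A₁ ℂ) (Y : Matrix A₂ A₂ ℂ) :
    conjLin (V ⊗ₖ W) (X ⊗ₖ Y) = conjLin V X ⊗ₖ conjLin W Y := by
  simp only [conjLin_apply, conjTranspose_kronecker, mul_kronecker_mul]

theorem conjLin_one {A : Type*} [Fintype A] [DecidableEq A] (X : Matrix A A ℂ) :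
    conjLin (1 : Matrix A A ℂ) X = X := by simp [conjLin_apply]

theorem conjLin_conjLin {A B C : Type*} [Fintype A] [Fintype B] (V : Matrix B A ℂ)
    (W : Matrix C B ℂ) (X : Matrix A A ℂ) : conjLin W (conjLin V X) = conjLin (W * V) X := by
  simp only [conjLin_apply, conjTranspose_mul, Matrix.mul_assoc]

theorem posSemidef_conjLin {A B : Type*} [Fintype A] [Fintype B] (V : Matrix B A ℂ)
    {X : Matrix A A ℂ} (hX : X.PosSemidef) : (conjLin V X).PosSemidef :=
  hX.mul_mul_conjTranspose_same V

theorem trace_conjLin {A B : Type*} [Fintype A] [Fintype B] [DecidableEq A] {V : Matrix B A ℂ}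
    (hV : Vᴴ * V = 1) (X : Matrix A A ℂ) : (conjLin V X).trace = X.trace := by
  rw [conjLin_apply, Matrix.mul_assoc, trace_mul_comm, Matrix.mul_assoc, hV, Matrix.mul_one]

/-- Positive trace-preserving maps. For tensor products of channels only this consequence of complete
positivity is needed. -/
structure IsPTP {A B : Type u} [Fintype A] [Fintype B]
    (T : Matrix A A ℂ →ₗ[ℂ] Matrix B B ℂ) : Prop where
  positive : ∀ M : Matrix A A ℂ, M.PosSemidef → (T M).PosSemidef
  trace_preserving : ∀ M : Matrix A A ℂ, (T M).trace = M.trace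

/-- Complete positivity for block matrices indexed by an arbitrary finite type. -/
theorem IsCompletelyPositive.posSemidef_comp_map {A B : Type u} [Fintype A] [Fintype B]
    {T : Matrix A A ℂ →ₗ[ℂ] Matrix B B ℂ} (hT : IsCompletelyPositive T) {K : Type*} [Fintype K]
    (M : Matrix K K (Matrix A A ℂ)) (hM : (Matrix.comp K K A A ℂ M).PosSemidef) :
    (Matrix.comp K K B B ℂ (M.map T)).PosSemidef := by
  have e := Fintype.equivFin K
  have h1 := hT _ (M.submatrix e.symm e.symm) (hM.submatrix (Prod.map e.symm id))
  convert h1.submatrix (Prod.map e id) using 1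
  ext ⟨i, a⟩ ⟨j, b⟩
  simp

theorem IsCompletelyPositive.positive {A B : Type u} [Fintype A] [Fintype B]
    {T : Matrix A A ℂ →ₗ[ℂ] Matrix B B ℂ} (hT : IsCompletelyPositive T)
    {M : Matrix A A ℂ} (hM : M.PosSemidef) : (T M).PosSemidef := by
  have h1 := hT.posSemidef_comp_map (K := Unit) (Matrix.of fun _ _ => M) (hM.submatrix Prod.snd)
  exact h1.submatrix (fun b => ((), b))

theorem IsChannel.isPTP {A B : Type u} [Fintype A] [Fintype B]
    {T : Matrix A A ℂ →ₗ[ℂ] Matrix B B ℂ} (hT : IsChannel T) : IsPTP T :=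
  ⟨fun _ hM => hT.completelyPositive.positive hM, hT.trace_preserving⟩

section tensor
variable {A₁ B₁ A₂ B₂ : Type u} [Fintype A₁] [DecidableEq A₁]
    [Fintype B₁] [DecidableEq B₁] [Fintype A₂] [DecidableEq A₂] [Fintype B₂] [DecidableEq B₂]
    {T₁ : Matrix A₁ A₁ ℂ →ₗ[ℂ] Matrix B₁ B₁ ℂ} {T₂ : Matrix A₂ A₂ ℂ →ₗ[ℂ] Matrix B₂ B₂ ℂ}

/-- `id ⊗ T` is the entrywise application of `T` to a block matrix, as in the definition of complete
positivity. -/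
theorem tensor_id_apply (T : Matrix A₂ A₂ ℂ →ₗ[ℂ] Matrix B₂ B₂ ℂ)
    (M : Matrix (A₁ × A₂) (A₁ × A₂) ℂ) :
    tensor (LinearMap.id : Matrix A₁ A₁ ℂ →ₗ[ℂ] _) T M =
      Matrix.comp A₁ A₁ B₂ B₂ ℂ (((Matrix.comp A₁ A₁ A₂ A₂ ℂ).symm M).map T) := by
  induction M using kronecker_induction with
  | add M N hM hN =>
    rw [map_add, hM, hN]
    ext ⟨i, a⟩ ⟨j, b⟩
    simp only [Matrix.add_apply, comp_apply, Matrix.map_apply]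
    rw [← Matrix.add_apply, ← map_add]
    rfl
  | kron X Y =>
    rw [tensor_kronecker]
    ext ⟨i, a⟩ ⟨j, b⟩
    have h1 : (Matrix.comp A₁ A₁ A₂ A₂ ℂ).symm (X ⊗ₖ Y) i j = X i j • Y := by
      ext k l; simp
    simp only [comp_apply, Matrix.map_apply]
    rw [h1]
    simp

theorem tensor_eq_swap (M : Matrix (A₁ × A₂) (A₁ × A₂) ℂ) :
    tensor T₁ T₂ M = (tensor T₂ T₁ (M.submatrix Prod.swap Prod.swap)).submatrix
      Prod.swap Prod.swap := by
  induction M using kronecker_induction with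
  | add M N hM hN =>
    have h1 : (M + N).submatrix Prod.swap Prod.swap =
        M.submatrix Prod.swap Prod.swap + N.submatrix Prod.swap Prod.swap := rfl
    rw [map_add, hM, hN, h1, map_add]
    rfl
  | kron X Y =>
    have h1 : (X ⊗ₖ Y).submatrix Prod.swap Prod.swap = Y ⊗ₖ X := by
      ext ⟨i, a⟩ ⟨j, b⟩; simp [mul_comm]
    rw [h1, tensor_kronecker, tensor_kronecker]
    ext ⟨i, a⟩ ⟨j, b⟩
    simp [mul_comm]

theorem tensor_comp {C₁ C₂ : Type u} [Fintype C₁] [DecidableEq C₁] [Fintype C₂] [DecidableEq C₂]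
    (S₁ : Matrix B₁ B₁ ℂ →ₗ[ℂ] Matrix C₁ C₁ ℂ) (S₂ : Matrix B₂ B₂ ℂ →ₗ[ℂ] Matrix C₂ C₂ ℂ)
    (M : Matrix (A₁ × A₂) (A₁ × A₂) ℂ) :
    tensor S₁ S₂ (tensor T₁ T₂ M) = tensor (S₁ ∘ₗ T₁) (S₂ ∘ₗ T₂) M := by
  induction M using kronecker_induction with
  | add M N hM hN => simp only [map_add, hM, hN]
  | kron X Y => simp only [tensor_kronecker, LinearMap.comp_apply]

theorem tensor_id_positive (hT : IsCompletelyPositive T₂) {M : Matrix (A₁ × A₂) (A₁ × A₂) ℂ}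
    (hM : M.PosSemidef) :
    (tensor (LinearMap.id : Matrix A₁ A₁ ℂ →ₗ[ℂ] _) T₂ M).PosSemidef := by
  rw [tensor_id_apply]
  exact hT.posSemidef_comp_map _ (by simpa using hM)

theorem trace_tensor (h₁ : ∀ X, (T₁ X).trace = X.trace) (h₂ : ∀ X, (T₂ X).trace = X.trace)
    (M : Matrix (A₁ × A₂) (A₁ × A₂) ℂ) : (tensor T₁ T₂ M).trace = M.trace := by
  induction M using kronecker_induction with
  | add M N hM hN => simp only [map_add, hM, hN, Matrix.trace_add]
  | kron X Y => simp only [tensor_kronecker, trace_kronecker, h₁, h₂]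

theorem IsChannel.isPTP_tensor (h₁ : IsChannel T₁) (h₂ : IsChannel T₂) :
    IsPTP (tensor T₁ T₂) where
  -- `T₁ ⊗ T₂ = (T₁ ⊗ id) ∘ (id ⊗ T₂)`, and `T₁ ⊗ id` is `id ⊗ T₁` up to a swap.
  positive M hM := by
    have h3 := tensor_id_positive (A₁ := A₁) h₂.completelyPositive hM
    have h4 := tensor_id_positive (A₁ := B₂) h₁.completelyPositive (h3.submatrix Prod.swap)
    have h5 := h4.submatrix Prod.swap
    rw [← tensor_eq_swap, tensor_comp] at h5
    exact h5
  trace_preserving := trace_tensor h₁.trace_preserving h₂.trace_preserving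

end tensor

/-! ### Direct sums of channels -/

/-- `T` is the direct sum of the maps `S i`: it cuts the input into its diagonal blocks along the
isometries `V i`, whose ranges decompose the input space, applies `S i` to the `i`-th block and puts
the results into orthogonal blocks of the output space along the isometries `W i`. Stating this as a
property of `T`, without fixing the index types, makes it stable under tensor products on the nose. -/
structure IsDirectSum {ι : Type*} [Fintype ι] {A B : Type u} {A' B' : ι → Type u}
    [Fintype A] [DecidableEq A] [Fintype B] [∀ i, Fintype (A' i)] [∀ i, DecidableEq (A' i)]
    [∀ i, Fintype (B' i)] [∀ i, DecidableEq (B' i)]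
    (T : Matrix A A ℂ →ₗ[ℂ] Matrix B B ℂ)
    (S : ∀ i, Matrix (A' i) (A' i) ℂ →ₗ[ℂ] Matrix (B' i) (B' i) ℂ)
    (V : ∀ i, Matrix A (A' i) ℂ) (W : ∀ i, Matrix B (B' i) ℂ) : Prop where
  isometry_in : ∀ i, (V i)ᴴ * V i = 1
  orthogonal_in : ∀ i j, i ≠ j → (V i)ᴴ * V j = 0
  complete_in : ∑ i, V i * (V i)ᴴ = 1
  isometry_out : ∀ i, (W i)ᴴ * W i = 1
  orthogonal_out : ∀ i j, i ≠ j → (W i)ᴴ * W j = 0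
  apply_eq : ∀ X, T X = ∑ i, conjLin (W i) (S i (conjLin (V i)ᴴ X))

namespace IsDirectSum

variable {ι : Type*} [Fintype ι] {A B : Type u} {A' B' : ι → Type u}
    [Fintype A] [DecidableEq A] [Fintype B] [∀ i, Fintype (A' i)] [∀ i, DecidableEq (A' i)]
    [∀ i, Fintype (B' i)] [∀ i, DecidableEq (B' i)]
    {T : Matrix A A ℂ →ₗ[ℂ] Matrix B B ℂ}
    {S : ∀ i, Matrix (A' i) (A' i) ℂ →ₗ[ℂ] Matrix (B' i) (B' i) ℂ}
    {V : ∀ i, Matrix A (A' i) ℂ} {W : ∀ i, Matrix B (B' i) ℂ}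

theorem apply_conj (h : IsDirectSum T S V W) (i : ι) (X : Matrix (A' i) (A' i) ℂ) :
    T (conjLin (V i) X) = conjLin (W i) (S i X) := by
  rw [h.apply_eq, Finset.sum_eq_single i]
  · rw [conjLin_conjLin, h.isometry_in, conjLin_one]
  · intro j _ hj
    rw [conjLin_conjLin, h.orthogonal_in j i hj]
    simp [conjLin_apply]
  · simp

theorem sum_trace (h : IsDirectSum T S V W) (X : Matrix A A ℂ) :
    ∑ i, (conjLin (V i)ᴴ X).trace = X.trace := by
  have h1 : ∀ i, (conjLin (V i)ᴴ X).trace = (V i * (V i)ᴴ * X).trace := fun i => by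
    rw [conjLin_apply, conjTranspose_conjTranspose, trace_mul_comm, Matrix.mul_assoc]
  rw [Finset.sum_congr rfl fun i _ => h1 i, ← trace_sum, ← Finset.sum_mul, h.complete_in,
    Matrix.one_mul]

/-- The tensor product of two direct sums is the direct sum of all tensor products of summands. -/
theorem tensor [DecidableEq B] {κ : Type*} [Fintype κ] {C D : Type u} {C' D' : κ → Type u}
    [Fintype C] [DecidableEq C] [Fintype D] [DecidableEq D]
    [∀ i, Fintype (C' i)] [∀ i, DecidableEq (C' i)]
    [∀ i, Fintype (D' i)] [∀ i, DecidableEq (D' i)]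
    {T' : Matrix C C ℂ →ₗ[ℂ] Matrix D D ℂ}
    {S' : ∀ i, Matrix (C' i) (C' i) ℂ →ₗ[ℂ] Matrix (D' i) (D' i) ℂ}
    {V' : ∀ i, Matrix C (C' i) ℂ} {W' : ∀ i, Matrix D (D' i) ℂ}
    (h : IsDirectSum T S V W) (h' : IsDirectSum T' S' V' W') :
    IsDirectSum (ι := ι × κ) (A' := fun i => A' i.1 × C' i.2) (B' := fun i => B' i.1 × D' i.2)
      (tensor T T') (fun i => tensor (S i.1) (S' i.2)) (fun i => V i.1 ⊗ₖ V' i.2)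
      (fun i => W i.1 ⊗ₖ W' i.2) where
  isometry_in i := by
    rw [conjTranspose_kronecker, ← mul_kronecker_mul, h.isometry_in, h'.isometry_in,
      one_kronecker_one]
  isometry_out i := by
    rw [conjTranspose_kronecker, ← mul_kronecker_mul, h.isometry_out, h'.isometry_out,
      one_kronecker_one]
  orthogonal_in i j hij := by
    rw [conjTranspose_kronecker, ← mul_kronecker_mul]
    by_cases h1 : i.1 = j.1
    · rw [h'.orthogonal_in _ _ fun h2 => hij (Prod.ext h1 h2), kronecker_zero]
    · rw [h.orthogonal_in _ _ h1, zero_kronecker]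
  orthogonal_out i j hij := by
    rw [conjTranspose_kronecker, ← mul_kronecker_mul]
    by_cases h1 : i.1 = j.1
    · rw [h'.orthogonal_out _ _ fun h2 => hij (Prod.ext h1 h2), kronecker_zero]
    · rw [h.orthogonal_out _ _ h1, zero_kronecker]
  complete_in := by
    simp only [conjTranspose_kronecker, ← mul_kronecker_mul]
    rw [Fintype.sum_prod_type, ← one_kronecker_one, ← h.complete_in, ← h'.complete_in]
    ext ⟨i, j⟩ ⟨k, l⟩
    simp only [Matrix.sum_apply, kroneckerMap_apply, Finset.sum_mul_sum]
  apply_eq X := by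
    induction X using kronecker_induction with
    | add M N hM hN => simp only [map_add, hM, hN, Finset.sum_add_distrib]
    | kron X Y =>
      simp only [conjTranspose_kronecker, conjLin_kronecker, tensor_kronecker]
      rw [h.apply_eq X, h'.apply_eq Y, Fintype.sum_prod_type]
      ext ⟨i, j⟩ ⟨k, l⟩
      simp only [Matrix.sum_apply, kroneckerMap_apply, Finset.sum_mul_sum]

end IsDirectSum

section directSum

variable {ι : Type} [DecidableEq ι] {A B : ι → Type u} [∀ i, DecidableEq (A i)]

/-- The isometry `ℂ^(A i) → ⨁ i, ℂ^(A i)` including the `i`-th summand. -/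
def incl (A : ι → Type u) [∀ i, DecidableEq (A i)] (i : ι) : Matrix (Σ i, A i) (A i) ℂ :=
  Matrix.of fun a x => if a = ⟨i, x⟩ then 1 else 0

variable [Fintype ι] [∀ i, Fintype (A i)]

theorem incl_conjTranspose_mul (i j : ι) (x : A i) (y : A j) :
    ((incl A i)ᴴ * incl A j) x y =
      if (⟨j, y⟩ : Σ i, A i) = ⟨i, x⟩ then 1 else 0 := by
  simp [incl, Matrix.mul_apply]

variable [∀ i, Fintype (B i)] [∀ i, DecidableEq (B i)]

/-- The direct sum of a family of linear maps, on the disjoint unions of the index types: all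
off-diagonal input blocks are discarded. -/
def directSum (S : ∀ i, Matrix (A i) (A i) ℂ →ₗ[ℂ] Matrix (B i) (B i) ℂ) :
    Matrix (Σ i, A i) (Σ i, A i) ℂ →ₗ[ℂ] Matrix (Σ i, B i) (Σ i, B i) ℂ :=
  ∑ i, conjLin (incl B i) ∘ₗ S i ∘ₗ conjLin (incl A i)ᴴ

theorem isDirectSum_directSum (S : ∀ i, Matrix (A i) (A i) ℂ →ₗ[ℂ] Matrix (B i) (B i) ℂ) :
    IsDirectSum (directSum S) S (incl A) (incl B) where
  isometry_in i := by
    ext a b; rw [incl_conjTranspose_mul]; simp [Matrix.one_apply, eq_comm]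
  isometry_out i := by
    ext a b; rw [incl_conjTranspose_mul]; simp [Matrix.one_apply, eq_comm]
  orthogonal_in i j hij := by
    ext a b; rw [incl_conjTranspose_mul]; simp [hij.symm]
  orthogonal_out i j hij := by
    ext a b; rw [incl_conjTranspose_mul]; simp [hij.symm]
  complete_in := by
    ext a b
    rw [Matrix.sum_apply]
    simp only [incl, Matrix.mul_apply, conjTranspose_apply, of_apply]
    refine (Fintype.sum_sigma (fun c : Σ i, A i => (if a = c then (1 : ℂ) else 0) *
      star (if b = c then (1 : ℂ) else 0))).symm.trans ?_
    simp [Matrix.one_apply]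
  apply_eq X := by simp [directSum]

theorem isChannel_directSum {S : ∀ i, Matrix (A i) (A i) ℂ →ₗ[ℂ] Matrix (B i) (B i) ℂ}
    (hS : ∀ i, IsChannel (S i)) : IsChannel (directSum S) where
  trace_preserving M := by
    have h := isDirectSum_directSum S
    rw [h.apply_eq, trace_sum, ← h.sum_trace M]
    exact Finset.sum_congr rfl fun i _ => by
      rw [trace_conjLin (h.isometry_out i), (hS i).trace_preserving]
  completelyPositive k M hM := by
    have h := isDirectSum_directSum S
    -- Blockwise conjugation by `V` is conjugation of the whole block matrix by `1 ⊗ V`.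
    have key : ∀ (A B : Type u) [Fintype A] [Fintype B] (V : Matrix B A ℂ)
        (M : Matrix (Fin k) (Fin k) (Matrix A A ℂ)), (Matrix.comp _ _ A A ℂ M).PosSemidef →
        (Matrix.comp _ _ B B ℂ (M.map (conjLin V))).PosSemidef := by
      intro A B _ _ V M hM
      convert posSemidef_conjLin ((1 : Matrix (Fin k) (Fin k) ℂ) ⊗ₖ V) hM using 1
      ext ⟨i, a⟩ ⟨j, b⟩
      simp [conjLin_apply, Matrix.mul_apply, Fintype.sum_prod_type, Matrix.one_apply,
        apply_ite (starRingEnd ℂ)]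
    have h1 : Matrix.comp _ _ _ _ ℂ (M.map (directSum S)) =
        ∑ i, Matrix.comp _ _ _ _ ℂ
          (((M.map (conjLin (incl A i)ᴴ)).map (S i)).map (conjLin (incl B i))) := by
      ext ⟨i, a⟩ ⟨j, b⟩
      simp only [comp_apply, Matrix.map_apply, h.apply_eq, Matrix.sum_apply]
    rw [h1]
    exact posSemidef_sum _ fun i _ =>
      key _ _ _ _ ((hS i).completelyPositive _ _ (key _ _ _ _ hM))

end directSum

/-! ### The function `- x log₂ x` -/

/-- The function `η x = - x log₂ x`, with `η 0 = 0`. -/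
noncomputable def eta (x : ℝ) : ℝ := -(x * Real.logb 2 x)

@[simp] theorem eta_zero : eta 0 = 0 := by simp [eta]

@[simp] theorem eta_one : eta 1 = 0 := by simp [eta]

theorem eta_eq (x : ℝ) : eta x = Real.negMulLog x / Real.log 2 := by
  rw [eta, Real.negMulLog, Real.logb]; ring

theorem eta_mul (x y : ℝ) : eta (x * y) = y * eta x + x * eta y := by
  rw [eta_eq, eta_eq, eta_eq, Real.negMulLog_mul]; ring

theorem eta_nonneg {x : ℝ} (h0 : 0 ≤ x) (h1 : x ≤ 1) : 0 ≤ eta x := by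
  rw [eta_eq]
  exact div_nonneg (Real.negMulLog_nonneg h0 h1) (Real.log_nonneg one_le_two)

theorem eta_le {x : ℝ} (h0 : 0 ≤ x) : eta x ≤ 1 / Real.log 2 := by
  rw [eta_eq]
  have := Real.negMulLog_le_one_sub_self h0
  exact div_le_div_of_nonneg_right (by linarith) (Real.log_nonneg one_le_two)

/-! ### Spectra of states -/

section
variable {B C : Type*} [Fintype B] [Fintype C] [DecidableEq C]
  {M : Matrix B B ℂ} {V : Matrix B C ℂ} {d : C → ℝ}

theorem SpecDecomp.sum_eq_one (h : SpecDecomp M V d) (hM : M.trace = 1) : ∑ c, d c = 1 := by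
  rw [h.trace_eq] at hM; exact_mod_cast hM

theorem SpecDecomp.le_one (h : SpecDecomp M V d) (hM : M.PosSemidef) (hM' : M.trace = 1) (c : C) :
    d c ≤ 1 := by
  rw [← h.sum_eq_one hM']
  exact Finset.single_le_sum (fun i _ => h.nonneg hM i) (Finset.mem_univ c)

theorem SpecDecomp.norm_pos (h : SpecDecomp M V d) (hM : M.trace = 1) : 0 < ‖d‖ := by
  rw [norm_pos_iff]
  rintro rfl
  simpa using h.sum_eq_one hM

theorem SpecDecomp.sum_rpow_pos (h : SpecDecomp M V d) (hM : M.PosSemidef) (hM' : M.trace = 1)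
    (p : ℝ) : 0 < ∑ c, d c ^ p := by
  have h1 : ∃ c, d c ≠ 0 := by
    by_contra! hd
    simpa [hd] using h.sum_eq_one hM'
  obtain ⟨c, hc⟩ := h1
  exact Finset.sum_pos' (fun i _ => Real.rpow_nonneg (h.nonneg hM i) _)
    ⟨c, Finset.mem_univ _, Real.rpow_pos_of_pos (lt_of_le_of_ne (h.nonneg hM c) hc.symm) _⟩

theorem SpecDecomp.norm_le_one (h : SpecDecomp M V d) (hM : M.PosSemidef) (hM' : M.trace = 1) :
    ‖d‖ ≤ 1 :=
  (pi_norm_le_iff_of_nonneg zero_le_one).2 fun c => by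
    rw [Real.norm_of_nonneg (h.nonneg hM c)]; exact h.le_one hM hM' c

theorem SpecDecomp.sum_rpow_le_one (h : SpecDecomp M V d) (hM : M.PosSemidef) (hM' : M.trace = 1)
    {p : ℝ} (hp : 1 ≤ p) : ∑ c, d c ^ p ≤ 1 := by
  rw [← h.sum_eq_one hM']
  exact Finset.sum_le_sum fun c _ =>
    Real.rpow_le_self_of_le_one (h.nonneg hM c) (h.le_one hM hM' c) hp

end

/-! ### von Neumann entropy -/

section
variable {B : Type u} [Fintype B] [DecidableEq B] {M : Matrix B B ℂ}

theorem SpecDecomp.vonNeumannEntropy_eq {C : Type*} [Fintype C] [DecidableEq C]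
    {V : Matrix B C ℂ} {d : C → ℝ} (h : SpecDecomp M V d) :
    vonNeumannEntropy M = ∑ c, eta (d c) := by
  rw [vonNeumannEntropy]
  exact h.trace_cfc (f := eta) eta_zero

theorem vonNeumannEntropy_conjLin (hM : M.IsHermitian) {B' : Type u} [Fintype B'] [DecidableEq B']
    {W : Matrix B' B ℂ} (hW : Wᴴ * W = 1) :
    vonNeumannEntropy (conjLin W M) = vonNeumannEntropy M := by
  obtain ⟨V, d, h⟩ := exists_specDecomp hM
  rw [h.vonNeumannEntropy_eq]
  exact (h.conj hW).vonNeumannEntropy_eq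

theorem vonNeumannEntropy_smul (hM : M.IsHermitian) (t : ℝ) :
    vonNeumannEntropy ((t : ℂ) • M) = t * vonNeumannEntropy M + eta t * M.trace.re := by
  obtain ⟨V, d, h⟩ := exists_specDecomp hM
  rw [h.vonNeumannEntropy_eq, (h.smul t).vonNeumannEntropy_eq, h.trace_eq, Complex.ofReal_re,
    Finset.mul_sum, Finset.mul_sum, ← Finset.sum_add_distrib]
  exact Finset.sum_congr rfl fun c _ => by rw [eta_mul]; ring

theorem vonNeumannEntropy_kronecker (hM : M.IsHermitian) {B' : Type u} [Fintype B']
    [DecidableEq B'] {N : Matrix B' B' ℂ} (hN : N.IsHermitian) :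
    vonNeumannEntropy (M ⊗ₖ N) =
      N.trace.re * vonNeumannEntropy M + M.trace.re * vonNeumannEntropy N := by
  obtain ⟨V, d, h⟩ := exists_specDecomp hM
  obtain ⟨V', d', h'⟩ := exists_specDecomp hN
  rw [h.vonNeumannEntropy_eq, h'.vonNeumannEntropy_eq, (h.kronecker h').vonNeumannEntropy_eq,
    h.trace_eq, h'.trace_eq, Complex.ofReal_re, Complex.ofReal_re, Fintype.sum_prod_type]
  simp only [eta_mul, Finset.sum_add_distrib, ← Finset.sum_mul, ← Finset.mul_sum]

theorem vonNeumannEntropy_sum {ι : Type*} [Fintype ι] [DecidableEq ι] {B' : ι → Type u}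
    [∀ i, Fintype (B' i)] [∀ i, DecidableEq (B' i)] {W : ∀ i, Matrix B (B' i) ℂ}
    (hW : ∀ i, (W i)ᴴ * W i = 1) (hW' : ∀ i j, i ≠ j → (W i)ᴴ * W j = 0)
    {N : ∀ i, Matrix (B' i) (B' i) ℂ} (hN : ∀ i, (N i).IsHermitian) :
    vonNeumannEntropy (∑ i, conjLin (W i) (N i)) = ∑ i, vonNeumannEntropy (N i) := by
  choose V d h using fun i => exists_specDecomp (hN i)
  simp only [fun i => (h i).vonNeumannEntropy_eq]
  refine (SpecDecomp.sum hW hW' h).vonNeumannEntropy_eq.trans ?_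
  rw [Fintype.sum_sigma]

theorem vonNeumannEntropy_nonneg (hM : M.PosSemidef) (hM' : M.trace = 1) :
    0 ≤ vonNeumannEntropy M := by
  obtain ⟨V, d, h⟩ := exists_specDecomp hM.isHermitian
  rw [h.vonNeumannEntropy_eq]
  exact Finset.sum_nonneg fun c _ => eta_nonneg (h.nonneg hM c) (h.le_one hM hM' c)

theorem vonNeumannEntropy_le (hM : M.PosSemidef) :
    vonNeumannEntropy M ≤ Fintype.card B * (1 / Real.log 2) := by
  obtain ⟨V, d, h⟩ := exists_specDecomp hM.isHermitian
  rw [h.vonNeumannEntropy_eq]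
  refine (Finset.sum_le_card_nsmul _ _ _ fun c _ => eta_le (h.nonneg hM c)).trans ?_
  simp

end

/-! ### Rényi entropies -/

section
variable {B : Type u} [Fintype B] [DecidableEq B] {M : Matrix B B ℂ} {α : ℝ≥0∞}

theorem one_lt_toReal (h1 : 1 < α) (h2 : α ≠ ∞) : 1 < α.toReal := by
  rwa [← ENNReal.ofReal_lt_iff_lt_toReal zero_le_one h2, ENNReal.ofReal_one]

theorem renyiEntropy_one : renyiEntropy 1 M = vonNeumannEntropy M := by simp [renyiEntropy]

section
variable {C : Type*} [Fintype C] [DecidableEq C] {V : Matrix B C ℂ} {d : C → ℝ}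

theorem SpecDecomp.renyiEntropy_top (h : SpecDecomp M V d) :
    renyiEntropy ∞ M = -Real.logb 2 ‖d‖ := by
  rw [renyiEntropy, if_neg (by simp), if_pos rfl, h.norm_eq]

theorem SpecDecomp.renyiEntropy_of_lt (h : SpecDecomp M V d) (h1 : 1 < α) (h2 : α ≠ ∞) :
    renyiEntropy α M = 1 / (1 - α.toReal) * Real.logb 2 (∑ c, d c ^ α.toReal) := by
  have h3 := one_lt_toReal h1 h2
  rw [renyiEntropy, if_neg h1.ne', if_neg h2,
    h.trace_cfc (f := fun x => x ^ α.toReal) (Real.zero_rpow (by linarith))]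

end

theorem renyiEntropy_conjLin (hα : 1 ≤ α) (hM : M.IsHermitian) {B' : Type u} [Fintype B']
    [DecidableEq B'] {W : Matrix B' B ℂ} (hW : Wᴴ * W = 1) :
    renyiEntropy α (conjLin W M) = renyiEntropy α M := by
  obtain ⟨V, d, h⟩ := exists_specDecomp hM
  have h' : SpecDecomp (conjLin W M) _ _ := h.conj hW
  rcases hα.eq_or_lt with rfl | h1
  · rw [renyiEntropy_one, renyiEntropy_one, vonNeumannEntropy_conjLin hM hW]
  by_cases h2 : α = ∞
  · rw [h2, h.renyiEntropy_top, h'.renyiEntropy_top]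
  · rw [h.renyiEntropy_of_lt h1 h2, h'.renyiEntropy_of_lt h1 h2]

theorem renyiEntropy_nonneg (hα : 1 ≤ α) (hM : M.PosSemidef) (hM' : M.trace = 1) :
    0 ≤ renyiEntropy α M := by
  obtain ⟨V, d, h⟩ := exists_specDecomp hM.isHermitian
  rcases hα.eq_or_lt with rfl | h1
  · rw [renyiEntropy_one]
    exact vonNeumannEntropy_nonneg hM hM'
  by_cases h2 : α = ∞
  · rw [h2, h.renyiEntropy_top]
    have := Real.logb_nonpos one_lt_two (norm_nonneg d) (h.norm_le_one hM hM')
    linarith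
  · have h3 := one_lt_toReal h1 h2
    rw [h.renyiEntropy_of_lt h1 h2]
    exact mul_nonneg_of_nonpos_of_nonpos (div_nonpos_of_nonneg_of_nonpos zero_le_one (by linarith))
      (Real.logb_nonpos one_lt_two (h.sum_rpow_pos hM hM' _).le
        (h.sum_rpow_le_one hM hM' h3.le))

theorem norm_mul_prod {C D : Type*} [Fintype C] [Fintype D] (d : C → ℝ) (e : D → ℝ) :
    ‖fun c : C × D => d c.1 * e c.2‖ = ‖d‖ * ‖e‖ := by
  apply le_antisymm
  · refine (pi_norm_le_iff_of_nonneg (by positivity)).2 fun c => ?_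
    rw [norm_mul]
    exact mul_le_mul (norm_le_pi_norm d _) (norm_le_pi_norm e _) (norm_nonneg _) (norm_nonneg _)
  · have key : ∀ c, ‖d c‖ * ‖e‖ ≤ ‖fun c : C × D => d c.1 * e c.2‖ := fun c => by
      have h1 : ‖d c • e‖ ≤ ‖fun c : C × D => d c.1 * e c.2‖ :=
        (pi_norm_le_iff_of_nonneg (norm_nonneg _)).2 fun i =>
          norm_le_pi_norm (fun c : C × D => d c.1 * e c.2) (c, i)
      rwa [norm_smul] at h1
    have h2 : ‖‖e‖ • d‖ ≤ ‖fun c : C × D => d c.1 * e c.2‖ :=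
      (pi_norm_le_iff_of_nonneg (norm_nonneg _)).2 fun c => by
        rw [Pi.smul_apply, norm_smul, norm_norm, mul_comm]; exact key c
    rwa [norm_smul, norm_norm, mul_comm] at h2

theorem renyiEntropy_kronecker (hα : 1 ≤ α) (hM : M.PosSemidef) (hM' : M.trace = 1) {B' : Type u}
    [Fintype B'] [DecidableEq B'] {N : Matrix B' B' ℂ} (hN : N.PosSemidef) (hN' : N.trace = 1) :
    renyiEntropy α (M ⊗ₖ N) = renyiEntropy α M + renyiEntropy α N := by
  obtain ⟨V, d, h⟩ := exists_specDecomp hM.isHermitian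
  obtain ⟨V', d', h'⟩ := exists_specDecomp hN.isHermitian
  have hk := h.kronecker h'
  rcases hα.eq_or_lt with rfl | h1
  · simp [renyiEntropy_one, vonNeumannEntropy_kronecker hM.isHermitian hN.isHermitian, hM', hN']
  by_cases h2 : α = ∞
  · rw [h2, h.renyiEntropy_top, h'.renyiEntropy_top, hk.renyiEntropy_top, norm_mul_prod,
      Real.logb_mul (h.norm_pos hM').ne' (h'.norm_pos hN').ne']
    ring
  · rw [h.renyiEntropy_of_lt h1 h2, h'.renyiEntropy_of_lt h1 h2, hk.renyiEntropy_of_lt h1 h2,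
      ← mul_add, ← Real.logb_mul (h.sum_rpow_pos hM hM' _).ne' (h'.sum_rpow_pos hN hN' _).ne',
      Finset.sum_mul_sum, Fintype.sum_prod_type]
    simp only [Real.mul_rpow (h.nonneg hM _) (h'.nonneg hN _)]

/-- A block diagonal state `⨁ i, t i • N i` has at least the least Rényi entropy among the states `N i`.
For finite `α > 1` this holds because `∑ i, t i ^ α * tr (N i ^ α)` is at most a convex combination
of the numbers `tr (N i ^ α)`. -/
theorem le_renyiEntropy_sum (hα : 1 ≤ α) {ι : Type*} [Fintype ι] [DecidableEq ι] {B' : ι → Type u}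
    [∀ i, Fintype (B' i)] [∀ i, DecidableEq (B' i)] {W : ∀ i, Matrix B (B' i) ℂ}
    (hW : ∀ i, (W i)ᴴ * W i = 1) (hW' : ∀ i j, i ≠ j → (W i)ᴴ * W j = 0)
    {t : ι → ℝ} (ht : ∀ i, 0 ≤ t i) (ht' : ∑ i, t i = 1)
    {N : ∀ i, Matrix (B' i) (B' i) ℂ} (hN : ∀ i, (N i).PosSemidef) (hN' : ∀ i, (N i).trace = 1)
    {c : ℝ} (hc : ∀ i, c ≤ renyiEntropy α (N i)) :
    c ≤ renyiEntropy α (∑ i, conjLin (W i) ((t i : ℂ) • N i)) := by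
  have ht1 : ∀ i, t i ≤ 1 := fun i => by
    rw [← ht']; exact Finset.single_le_sum (fun j _ => ht j) (Finset.mem_univ i)
  choose V d h using fun i => exists_specDecomp (hN i).isHermitian
  have hs : SpecDecomp (∑ i, conjLin (W i) ((t i : ℂ) • N i)) _ _ :=
    SpecDecomp.sum hW hW' fun i => (h i).smul (t i)
  have hP : (∑ i, conjLin (W i) ((t i : ℂ) • N i)).PosSemidef :=
    posSemidef_sum _ fun i _ =>
      posSemidef_conjLin _ ((hN i).smul (Complex.zero_le_real.2 (ht i)))
  have hT : (∑ i, conjLin (W i) ((t i : ℂ) • N i)).trace = 1 := by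
    rw [trace_sum]
    simp only [fun i => trace_conjLin (hW i), trace_smul, hN', smul_eq_mul, mul_one]
    exact_mod_cast ht'
  rcases hα.eq_or_lt with rfl | h1
  · simp only [renyiEntropy_one] at hc ⊢
    rw [vonNeumannEntropy_sum hW hW' fun i =>
      ((hN i).smul (Complex.zero_le_real.2 (ht i))).isHermitian]
    calc c = ∑ i, t i * c := by rw [← Finset.sum_mul, ht', one_mul]
      _ ≤ _ := Finset.sum_le_sum fun i _ => by
        rw [vonNeumannEntropy_smul (hN i).isHermitian, hN']
        have := mul_le_mul_of_nonneg_left (hc i) (ht i)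
        have := eta_nonneg (ht i) (ht1 i)
        simp only [Complex.one_re]
        linarith
  by_cases h2 : α = ∞
  · subst h2
    rw [hs.renyiEntropy_top, le_neg, Real.logb_le_iff_le_rpow one_lt_two (hs.norm_pos hT)]
    refine (pi_norm_le_iff_of_nonneg (by positivity)).2 fun x => ?_
    have h3 := hc x.1
    rw [(h _).renyiEntropy_top, le_neg, Real.logb_le_iff_le_rpow one_lt_two
      ((h _).norm_pos (hN' _))] at h3
    rw [norm_mul, Real.norm_of_nonneg (ht _)]
    calc _ ≤ 1 * ‖d x.1‖ := mul_le_mul (ht1 _) (norm_le_pi_norm _ _) (norm_nonneg _) zero_le_one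
      _ ≤ _ := by rwa [one_mul]
  · have h3 := one_lt_toReal h1 h2
    have key : ∀ {S : ℝ}, 0 < S → (c ≤ 1 / (1 - α.toReal) * Real.logb 2 S ↔
        S ≤ 2 ^ (c * (1 - α.toReal))) := fun {S} hS => by
      rw [← Real.logb_le_iff_le_rpow one_lt_two hS, one_div_mul_eq_div,
        le_div_iff_of_neg (by linarith)]
    rw [hs.renyiEntropy_of_lt h1 h2, key (hs.sum_rpow_pos hP hT _), Fintype.sum_sigma]
    calc _ ≤ ∑ i, t i * (2 : ℝ) ^ (c * (1 - α.toReal)) := Finset.sum_le_sum fun i _ => by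
          have h4 := hc i
          rw [(h i).renyiEntropy_of_lt h1 h2, key ((h i).sum_rpow_pos (hN i) (hN' i) _)] at h4
          simp only [Real.mul_rpow (ht i) ((h i).nonneg (hN i) _)]
          rw [← Finset.mul_sum]
          exact mul_le_mul (Real.rpow_le_self_of_le_one (ht i) (ht1 i) h3.le) h4
            ((h i).sum_rpow_pos (hN i) (hN' i) _).le (ht i)
      _ = _ := by rw [← Finset.sum_mul, ht', one_mul]

end

/-! ### States -/

theorem trace_re_eq {A : Type*} [Fintype A] {X : Matrix A A ℂ} (hX : X.PosSemidef) :
    ((X.trace.re : ℝ) : ℂ) = X.trace := by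
  have h := hX.trace_nonneg
  rw [Complex.nonneg_iff] at h
  exact Complex.ext rfl h.2

theorem trace_re_nonneg {A : Type*} [Fintype A] {X : Matrix A A ℂ} (hX : X.PosSemidef) :
    0 ≤ X.trace.re := (Complex.nonneg_iff.1 hX.trace_nonneg).1

instance {A : Type u} [Fintype A] [DecidableEq A] [Nonempty A] : Nonempty (DensityMatrix A) := by
  obtain ⟨a⟩ := ‹Nonempty A›
  refine ⟨⟨diagonal (Pi.single a 1), ?_, ?_⟩⟩
  · refine PosSemidef.diagonal fun i => ?_
    by_cases h : i = a
    · subst h; simp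
    · simp [h]
  · simp [trace_diagonal]

theorem eq_zero_of_trace_re {A : Type*} [Fintype A] [DecidableEq A] {X : Matrix A A ℂ}
    (hX : X.PosSemidef) (h : X.trace.re = 0) : X = 0 := by
  rw [← hX.trace_eq_zero_iff, ← trace_re_eq hX, h, Complex.ofReal_zero]

/-- A positive semidefinite matrix is a multiple of a state, also when it is zero. -/
theorem exists_state {A : Type u} [Fintype A] [DecidableEq A] [Nonempty A] {X : Matrix A A ℂ}
    (hX : X.PosSemidef) : ∃ τ : DensityMatrix A, X = (X.trace.re : ℂ) • τ.1 := by
  by_cases h : X.trace.re = 0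
  · exact ⟨Classical.arbitrary _, by rw [eq_zero_of_trace_re hX h]; simp⟩
  · have h' : ((X.trace.re : ℝ) : ℂ) ≠ 0 := by exact_mod_cast h
    refine ⟨⟨((X.trace.re⁻¹ : ℝ) : ℂ) • X,
      hX.smul (Complex.zero_le_real.2 (inv_nonneg.2 (trace_re_nonneg hX))), ?_⟩, ?_⟩
    · rw [trace_smul, ← trace_re_eq hX, Complex.ofReal_inv, Complex.ofReal_re, smul_eq_mul,
        inv_mul_cancel₀ h']
    · rw [smul_smul, Complex.ofReal_inv, mul_inv_cancel₀ h', one_smul]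

/-! ### Ensembles with average supported on a subspace -/

open scoped MatrixOrder Matrix.Norms.L2Operator in
/-- Every member of positive weight in an ensemble whose average lives on the range of the isometry `V`
lives there as well: compressing the average to the orthogonal complement gives a sum of positive
semidefinite matrices that vanishes. -/
theorem conjLin_conjLin_conjTranspose_of_ensemble {A A' : Type*} [Fintype A] [DecidableEq A]
    [Fintype A'] [DecidableEq A'] {V : Matrix A A' ℂ} (hV : Vᴴ * V = 1) {n : ℕ} {p : Fin n → ℝ}
    (hp : ∀ k, 0 ≤ p k) {σ : Fin n → Matrix A A ℂ} (hσ : ∀ k, (σ k).PosSemidef)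
    {ρ : Matrix A' A' ℂ} (h : ∑ k, (p k : ℂ) • σ k = conjLin V ρ) {k : Fin n} (hk : p k ≠ 0) :
    conjLin V (conjLin Vᴴ (σ k)) = σ k := by
  -- `Q` is the projection onto the orthogonal complement of the range of `V`.
  set Q : Matrix A A ℂ := 1 - V * Vᴴ with hQ
  have hQH : Qᴴ = Q := by simp [hQ]
  have hQV : Q * V = 0 := by
    rw [hQ, Matrix.sub_mul, Matrix.mul_assoc, hV]; simp
  have h1 : ∑ k, p k * (conjLin Q (σ k)).trace.re = 0 := by
    have h2 := congrArg (fun X => (conjLin Q X).trace.re) h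
    simp only [conjLin_conjLin, hQV] at h2
    simpa [trace_sum, conjLin_apply, Matrix.mul_sum, Matrix.sum_mul] using h2
  rw [Finset.sum_eq_zero_iff_of_nonneg fun i _ =>
    mul_nonneg (hp i) (trace_re_nonneg (posSemidef_conjLin Q (hσ i)))] at h1
  have h2 := eq_zero_of_trace_re (posSemidef_conjLin Q (hσ k))
    ((mul_eq_zero.1 (h1 k (Finset.mem_univ k))).resolve_left hk)
  obtain ⟨C, hC⟩ := CStarAlgebra.nonneg_iff_eq_star_mul_self.1 (hσ k).nonneg
  rw [star_eq_conjTranspose] at hC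
  have h3 : C * Q = 0 := by
    rw [← conjTranspose_mul_self_eq_zero, conjTranspose_mul, hQH, ← h2, conjLin_apply, hQH, hC]
    simp only [Matrix.mul_assoc]
  have h4 : σ k * Q = 0 := by rw [hC, Matrix.mul_assoc, h3, Matrix.mul_zero]
  have h5 : Q * σ k = 0 := by
    have := congrArg conjTranspose h4
    rwa [conjTranspose_mul, hQH, (hσ k).isHermitian.eq, conjTranspose_zero] at this
  have h6 : σ k * (V * Vᴴ) = σ k := by
    rw [hQ, Matrix.mul_sub, Matrix.mul_one, sub_eq_zero] at h4; exact h4.symm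
  have h7 : V * Vᴴ * σ k = σ k := by
    rw [hQ, Matrix.sub_mul, Matrix.one_mul, sub_eq_zero] at h5; exact h5.symm
  rw [conjLin_conjLin, conjLin_apply, conjTranspose_mul, conjTranspose_conjTranspose, h7, h6]

/-! ### The convex closure along isometries -/

/-- The image `V ρ Vᴴ` of a state under an isometry. -/
def DensityMatrix.conj {A A' : Type u} [Fintype A] [Fintype A'] [DecidableEq A']
    {V : Matrix A A' ℂ} (hV : Vᴴ * V = 1) (ρ : DensityMatrix A') : DensityMatrix A :=
  ⟨conjLin V ρ.1, posSemidef_conjLin V ρ.2.1, by rw [trace_conjLin hV, ρ.2.2]⟩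

/-- The output state of a positive trace-preserving map. -/
def IsPTP.mapState {A B : Type u} [Fintype A] [Fintype B] {T : Matrix A A ℂ →ₗ[ℂ] Matrix B B ℂ}
    (hT : IsPTP T) (ρ : DensityMatrix A) : DensityMatrix B :=
  ⟨T ρ.1, hT.positive _ ρ.2.1, by rw [hT.trace_preserving, ρ.2.2]⟩

theorem IsPTP.posSemidef_apply {A B : Type u} [Fintype A] [Fintype B]
    {T : Matrix A A ℂ →ₗ[ℂ] Matrix B B ℂ} (hT : IsPTP T) (ρ : DensityMatrix A) :
    (T ρ.1).PosSemidef := (hT.mapState ρ).2.1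

theorem IsPTP.trace_apply {A B : Type u} [Fintype A] [Fintype B]
    {T : Matrix A A ℂ →ₗ[ℂ] Matrix B B ℂ} (hT : IsPTP T) (ρ : DensityMatrix A) :
    (T ρ.1).trace = 1 := (hT.mapState ρ).2.2

/-- If `T` restricts to `S` along the isometries `V` and `W`, then `H_T` restricts to `H_S`, because the
ensembles of `V ρ Vᴴ` are exactly the images of the ensembles of `ρ`. -/
theorem convexClosure_conjLin {A B A' B' : Type u} [Fintype A] [DecidableEq A] [Fintype B]
    [DecidableEq B] [Fintype A'] [DecidableEq A'] [Fintype B'] [DecidableEq B']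
    {T : Matrix A A ℂ →ₗ[ℂ] Matrix B B ℂ} {S : Matrix A' A' ℂ →ₗ[ℂ] Matrix B' B' ℂ}
    {V : Matrix A A' ℂ} {W : Matrix B B' ℂ} (hV : Vᴴ * V = 1) (hW : Wᴴ * W = 1)
    (hS : ∀ X, X.PosSemidef → (S X).PosSemidef)
    (h : ∀ X, T (conjLin V X) = conjLin W (S X)) (ρ : DensityMatrix A') :
    convexClosure T (conjLin V ρ.1) = convexClosure S ρ.1 := by
  have key : ∀ X, X.PosSemidef → vonNeumannEntropy (T (conjLin V X)) =
      vonNeumannEntropy (S X) := fun X hX => by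
    rw [h, vonNeumannEntropy_conjLin (hS _ hX).isHermitian hW]
  rw [convexClosure, convexClosure]
  congr 1
  ext x
  constructor
  · rintro ⟨n, p, σ, hp, hp', hσ, rfl⟩
    have h1 : ∀ k, p k ≠ 0 → conjLin V (conjLin Vᴴ (σ k).1) = (σ k).1 := fun k hk =>
      conjLin_conjLin_conjTranspose_of_ensemble hV hp (fun k => (σ k).2.1) hσ hk
    have h2 : ∀ k, p k ≠ 0 → (conjLin Vᴴ (σ k).1).trace = 1 := fun k hk => by
      rw [← trace_conjLin hV, h1 k hk, (σ k).2.2]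
    -- Members of weight zero need not live on the range of `V`; they are replaced by `ρ`.
    refine ⟨n, p, fun k => if hk : p k = 0 then ρ else
      ⟨conjLin Vᴴ (σ k).1, posSemidef_conjLin _ (σ k).2.1, h2 k hk⟩, hp, hp', ?_, ?_⟩
    · have h3 := congrArg (conjLin Vᴴ) hσ
      rw [conjLin_conjLin, hV, conjLin_one, map_sum] at h3
      rw [← h3]
      refine Finset.sum_congr rfl fun k _ => ?_
      rw [map_smul]
      by_cases hk : p k = 0
      · simp [hk]
      · simp [hk]
    · refine Finset.sum_congr rfl fun k _ => ?_
      by_cases hk : p k = 0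
      · simp [hk]
      · simp only [dif_neg hk]
        rw [← key _ (posSemidef_conjLin _ (σ k).2.1), h1 k hk]
  · rintro ⟨n, p, σ, hp, hp', hσ, rfl⟩
    refine ⟨n, p, fun k => (σ k).conj hV, hp, hp', ?_, ?_⟩
    · rw [← hσ, map_sum]
      exact Finset.sum_congr rfl fun k _ => (map_smul _ _ _).symm
    · exact Finset.sum_congr rfl fun k _ => by rw [← key _ (σ k).2.1]; rfl

/-! ### Reduced states -/

section reduced
variable {A₁ A₂ : Type u}

theorem reduced₁_kronecker [Fintype A₂] (X : Matrix A₁ A₁ ℂ) (Y : Matrix A₂ A₂ ℂ) :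
    reduced₁ (X ⊗ₖ Y) = Y.trace • X := by
  ext i j
  simp [reduced₁, Matrix.trace, Finset.mul_sum, mul_comm]

theorem reduced₂_kronecker [Fintype A₁] (X : Matrix A₁ A₁ ℂ) (Y : Matrix A₂ A₂ ℂ) :
    reduced₂ (X ⊗ₖ Y) = X.trace • Y := by
  ext i j
  simp [reduced₂, Matrix.trace, Finset.sum_mul]

theorem reduced₁_add [Fintype A₂] (M N : Matrix (A₁ × A₂) (A₁ × A₂) ℂ) :
    reduced₁ (M + N) = reduced₁ M + reduced₁ N := by
  ext i j; simp [reduced₁, Finset.sum_add_distrib]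

theorem reduced₂_add [Fintype A₁] (M N : Matrix (A₁ × A₂) (A₁ × A₂) ℂ) :
    reduced₂ (M + N) = reduced₂ M + reduced₂ N := by
  ext i j; simp [reduced₂, Finset.sum_add_distrib]

variable [Fintype A₁] [DecidableEq A₁] [Fintype A₂] [DecidableEq A₂]

variable {C₁ C₂ : Type u}

theorem reduced₁_conjLin [Fintype C₂] {V : Matrix C₁ A₁ ℂ} {W : Matrix C₂ A₂ ℂ} (hW : Wᴴ * W = 1)
    (M : Matrix (A₁ × A₂) (A₁ × A₂) ℂ) :
    reduced₁ (conjLin (V ⊗ₖ W) M) = conjLin V (reduced₁ M) := by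
  induction M using kronecker_induction with
  | add M N hM hN => simp only [map_add, reduced₁_add, hM, hN]
  | kron X Y => rw [conjLin_kronecker, reduced₁_kronecker, reduced₁_kronecker, trace_conjLin hW,
      map_smul]

theorem reduced₂_conjLin [Fintype C₁] {V : Matrix C₁ A₁ ℂ} {W : Matrix C₂ A₂ ℂ} (hV : Vᴴ * V = 1)
    (M : Matrix (A₁ × A₂) (A₁ × A₂) ℂ) :
    reduced₂ (conjLin (V ⊗ₖ W) M) = conjLin W (reduced₂ M) := by
  induction M using kronecker_induction with
  | add M N hM hN => simp only [map_add, reduced₂_add, hM, hN]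
  | kron X Y => rw [conjLin_kronecker, reduced₂_kronecker, reduced₂_kronecker, trace_conjLin hV,
      map_smul]

/-- The reduced state on the first subsystem. -/
def DensityMatrix.reduced₁ (ρ : DensityMatrix (A₁ × A₂)) : DensityMatrix A₁ :=
  ⟨QChannel.reduced₁ ρ.1, by
    have h : QChannel.reduced₁ ρ.1 =
        ∑ k, ρ.1.submatrix (fun i => (i, k)) (fun i => (i, k)) := by
      ext i j; simp [QChannel.reduced₁, Matrix.sum_apply]
    rw [h]
    exact posSemidef_sum _ fun k _ => ρ.2.1.submatrix _, by
    refine Eq.trans ?_ ρ.2.2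
    simp [QChannel.reduced₁, Matrix.trace, Fintype.sum_prod_type]⟩

/-- The reduced state on the second subsystem. -/
def DensityMatrix.reduced₂ (ρ : DensityMatrix (A₁ × A₂)) : DensityMatrix A₂ :=
  ⟨QChannel.reduced₂ ρ.1, by
    have h : QChannel.reduced₂ ρ.1 =
        ∑ k, ρ.1.submatrix (fun i => (k, i)) (fun i => (k, i)) := by
      ext i j; simp [QChannel.reduced₂, Matrix.sum_apply]
    rw [h]
    exact posSemidef_sum _ fun k _ => ρ.2.1.submatrix _, by
    refine Eq.trans ?_ ρ.2.2
    simp [QChannel.reduced₂, Matrix.trace, Fintype.sum_prod_type_right]⟩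

/-- The tensor product of two states. -/
def DensityMatrix.kron (ρ₁ : DensityMatrix A₁) (ρ₂ : DensityMatrix A₂) :
    DensityMatrix (A₁ × A₂) :=
  ⟨ρ₁.1 ⊗ₖ ρ₂.1, ρ₁.2.1.kronecker ρ₂.2.1, by rw [trace_kronecker, ρ₁.2.2, ρ₂.2.2, one_mul]⟩

end reduced

/-! ### The convex closure on blocks of a direct sum -/

section
variable {ι : Type} [Fintype ι] [DecidableEq ι] {A B : ι → Type u}
    [∀ i, Fintype (A i)] [∀ i, DecidableEq (A i)]
    [∀ i, Fintype (B i)] [∀ i, DecidableEq (B i)]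
    {S : ∀ i, Matrix (A i) (A i) ℂ →ₗ[ℂ] Matrix (B i) (B i) ℂ}

theorem convexClosure_directSum (hS : ∀ i, IsChannel (S i)) (i : ι) (ρ : DensityMatrix (A i)) :
    convexClosure (directSum S) (conjLin (incl A i) ρ.1) = convexClosure (S i) ρ.1 :=
  have h := isDirectSum_directSum S
  convexClosure_conjLin (h.isometry_in i) (h.isometry_out i) (hS i).isPTP.positive
    (h.apply_conj i) ρ

theorem convexClosure_tensor_directSum (hS : ∀ i, IsChannel (S i)) (i j : ι)
    (ρ : DensityMatrix (A i × A j)) :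
    convexClosure (tensor (directSum S) (directSum S))
      (conjLin (incl A i ⊗ₖ incl A j) ρ.1) = convexClosure (tensor (S i) (S j)) ρ.1 :=
  have h := (isDirectSum_directSum S).tensor (isDirectSum_directSum S)
  convexClosure_conjLin (h.isometry_in (i, j)) (h.isometry_out (i, j))
    ((hS i).isPTP_tensor (hS j)).positive (h.apply_conj (i, j)) ρ

theorem ConvexClosureStronglySuperadditive.of_directSum (hS : ∀ i, IsChannel (S i))
    (h : ConvexClosureStronglySuperadditive (directSum S) (directSum S)) (i j : ι) :
    ConvexClosureStronglySuperadditive (S i) (S j) := by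
  intro ρ
  have hd := isDirectSum_directSum S
  have h1 := h (ρ.conj ((hd.tensor hd).isometry_in (i, j)))
  simp only [DensityMatrix.conj] at h1
  rw [convexClosure_tensor_directSum hS, reduced₁_conjLin (hd.isometry_in j),
    reduced₂_conjLin (hd.isometry_in i)] at h1
  have h2 := convexClosure_directSum hS i ρ.reduced₁
  have h3 := convexClosure_directSum hS j ρ.reduced₂
  simp only [DensityMatrix.reduced₁, DensityMatrix.reduced₂] at h2 h3
  rwa [h2, h3] at h1

theorem ConvexClosureAdditiveOnProducts.of_directSum (hS : ∀ i, IsChannel (S i))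
    (h : ConvexClosureAdditiveOnProducts (directSum S) (directSum S)) (i j : ι) :
    ConvexClosureAdditiveOnProducts (S i) (S j) := by
  intro ρ₁ ρ₂
  have hd := isDirectSum_directSum S
  have h1 := h (ρ₁.conj (hd.isometry_in i)) (ρ₂.conj (hd.isometry_in j))
  simp only [DensityMatrix.conj] at h1
  rw [← conjLin_kronecker, convexClosure_directSum hS, convexClosure_directSum hS] at h1
  rw [← h1]
  exact (convexClosure_tensor_directSum hS i j (ρ₁.kron ρ₂)).symm

end

/-! ### The homogeneous entropy -/

/-- The homogeneous extension (of degree one) `S(M) - η(tr M)` of the von Neumann entropy from states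
to positive semidefinite matrices. It absorbs the probabilities of an ensemble into its members. -/
noncomputable def homEntropy {B : Type u} [Fintype B] [DecidableEq B] (M : Matrix B B ℂ) : ℝ :=
  vonNeumannEntropy M - eta M.trace.re

section
variable {B : Type u} [Fintype B] [DecidableEq B] {M : Matrix B B ℂ}

theorem homEntropy_of_trace_eq_one (hM : M.trace = 1) : homEntropy M = vonNeumannEntropy M := by
  simp [homEntropy, hM]

theorem homEntropy_smul (hM : M.IsHermitian) (t : ℝ) :
    homEntropy ((t : ℂ) • M) = t * homEntropy M := by
  rw [homEntropy, homEntropy, vonNeumannEntropy_smul hM, trace_smul, smul_eq_mul,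
    Complex.re_ofReal_mul, eta_mul]
  ring

theorem homEntropy_conjLin (hM : M.IsHermitian) {B' : Type u} [Fintype B'] [DecidableEq B']
    {W : Matrix B' B ℂ} (hW : Wᴴ * W = 1) : homEntropy (conjLin W M) = homEntropy M := by
  rw [homEntropy, homEntropy, vonNeumannEntropy_conjLin hM hW, trace_conjLin hW]

theorem homEntropy_kronecker (hM : M.PosSemidef) {B' : Type u} [Fintype B']
    [DecidableEq B'] {N : Matrix B' B' ℂ} (hN : N.PosSemidef) :
    homEntropy (M ⊗ₖ N) = N.trace.re * homEntropy M + M.trace.re * homEntropy N := by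
  rw [homEntropy, homEntropy, homEntropy,
    vonNeumannEntropy_kronecker hM.isHermitian hN.isHermitian, trace_kronecker, ← trace_re_eq hM,
    Complex.re_ofReal_mul, eta_mul, Complex.ofReal_re]
  ring

end

/-! ### The capacity in terms of ensembles -/

section
variable {A B : Type u} [Fintype A] [Fintype B] [DecidableEq B]
  {T : Matrix A A ℂ →ₗ[ℂ] Matrix B B ℂ}

theorem IsPTP.vonNeumannEntropy_nonneg (hT : IsPTP T) (ρ : DensityMatrix A) :
    0 ≤ vonNeumannEntropy (T ρ.1) :=
  QChannel.vonNeumannEntropy_nonneg (hT.posSemidef_apply ρ) (hT.trace_apply ρ)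

theorem IsPTP.homEntropy_state (hT : IsPTP T) (ρ : DensityMatrix A) :
    homEntropy (T ρ.1) = vonNeumannEntropy (T ρ.1) :=
  homEntropy_of_trace_eq_one (hT.trace_apply ρ)

theorem IsPTP.homEntropy_smul_state (hT : IsPTP T) (t : ℝ) (ρ : DensityMatrix A) :
    homEntropy (T ((t : ℂ) • ρ.1)) = t * vonNeumannEntropy (T ρ.1) := by
  rw [map_smul, homEntropy_smul (hT.positive _ ρ.2.1).isHermitian, hT.homEntropy_state]

theorem IsPTP.convexClosure_le {κ : Type*} [Fintype κ] (hT : IsPTP T) {p : κ → ℝ} (hp : ∀ k, 0 ≤ p k)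
    (hp' : ∑ k, p k = 1) (σ : κ → DensityMatrix A) {ρ : Matrix A A ℂ}
    (h : ∑ k, (p k : ℂ) • (σ k).1 = ρ) :
    convexClosure T ρ ≤ ∑ k, p k * vonNeumannEntropy (T (σ k).1) := by
  refine csInf_le ⟨0, ?_⟩ ?_
  · rintro x ⟨n, q, τ, hq, -, -, rfl⟩
    exact Finset.sum_nonneg fun k _ => mul_nonneg (hq k) (hT.vonNeumannEntropy_nonneg _)
  · let e := (Fintype.equivFin κ).symm
    refine ⟨_, p ∘ e, σ ∘ e, fun k => hp _, ?_, ?_, ?_⟩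
    · rw [← hp']; exact e.sum_comp p
    · rw [← h]; exact e.sum_comp fun k => (p k : ℂ) • (σ k).1
    · exact (e.sum_comp fun k => p k * vonNeumannEntropy (T (σ k).1)).symm

theorem IsPTP.convexClosure_nonneg (hT : IsPTP T) (ρ : Matrix A A ℂ) : 0 ≤ convexClosure T ρ := by
  refine Real.sInf_nonneg ?_
  rintro x ⟨n, q, τ, hq, -, -, rfl⟩
  exact Finset.sum_nonneg fun k _ => mul_nonneg (hq k) (hT.vonNeumannEntropy_nonneg _)

theorem IsPTP.le_hswCapacity (hT : IsPTP T) (ρ : DensityMatrix A) :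
    vonNeumannEntropy (T ρ.1) - convexClosure T ρ.1 ≤ hswCapacity T := by
  refine le_ciSup (f := fun ρ : DensityMatrix A =>
    vonNeumannEntropy (T ρ.1) - convexClosure T ρ.1) ⟨Fintype.card B * (1 / Real.log 2), ?_⟩ ρ
  rintro x ⟨σ, rfl⟩
  have h1 := vonNeumannEntropy_le (hT.positive _ σ.2.1)
  have h2 := hT.convexClosure_nonneg σ.1
  simp only
  linarith

end

section
variable {A B : Type u} [Fintype A] [DecidableEq A] [Fintype B] [DecidableEq B]
  {T : Matrix A A ℂ →ₗ[ℂ] Matrix B B ℂ} {κ : Type*} [Fintype κ]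

/-- The Holevo quantity of the ensemble `X` of unnormalised states: for `X k = p k • σ k` with average
`ρ` it is `S(T ρ) - ∑ k, p k * S(T (σ k))`. -/
noncomputable def gain (T : Matrix A A ℂ →ₗ[ℂ] Matrix B B ℂ) (X : κ → Matrix A A ℂ) : ℝ :=
  homEntropy (T (∑ k, X k)) - ∑ k, homEntropy (T (X k))

theorem IsPTP.gain_le [Nonempty A] (hT : IsPTP T) {X : κ → Matrix A A ℂ}
    (hX : ∀ k, (X k).PosSemidef) :
    gain T X ≤ (∑ k, X k).trace.re * hswCapacity T := by
  choose τ hτ using fun k => exists_state (hX k)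
  obtain ⟨ρ, hρ⟩ := exists_state (posSemidef_sum Finset.univ fun k _ => hX k)
  have ht0 : ∀ k, 0 ≤ (X k).trace.re := fun k => trace_re_nonneg (hX k)
  have ht : ∑ k, (X k).trace.re = (∑ k, X k).trace.re := by rw [trace_sum, Complex.re_sum]
  have h1 : gain T X = (∑ k, X k).trace.re * vonNeumannEntropy (T ρ.1) -
      ∑ k, (X k).trace.re * vonNeumannEntropy (T (τ k).1) := by
    rw [gain]
    congr 1
    · rw [← hT.homEntropy_smul_state, ← hρ]
    · exact Finset.sum_congr rfl fun k _ => by rw [← hT.homEntropy_smul_state, ← hτ]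
  set t := (∑ k, X k).trace.re with ht_def
  -- If the total trace `t` vanishes, both sides do; otherwise normalise by `t`.
  rcases (trace_re_nonneg (posSemidef_sum Finset.univ fun k _ => hX k)).eq_or_lt with h0 | h0
  · rw [← ht_def] at h0
    rw [← h0] at ht
    rw [Finset.sum_eq_zero_iff_of_nonneg fun k _ => ht0 k] at ht
    rw [h1, ← h0, Finset.sum_eq_zero fun k hk => by rw [ht k hk, zero_mul]]
    simp
  · rw [← ht_def] at h0
    have h2 := hT.convexClosure_le (p := fun k => t⁻¹ * (X k).trace.re)
      (fun k => mul_nonneg (inv_nonneg.2 h0.le) (ht0 k))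
      (by rw [← Finset.mul_sum, ht, inv_mul_cancel₀ h0.ne']) τ (ρ := ρ.1) (by
        simp only [Complex.ofReal_mul, ← smul_smul, ← hτ]
        rw [← Finset.smul_sum, hρ, smul_smul, Complex.ofReal_inv, inv_mul_cancel₀
          (by exact_mod_cast h0.ne'), one_smul])
    have h3 := hT.le_hswCapacity ρ
    simp only [mul_assoc] at h2
    rw [← Finset.mul_sum] at h2
    have h4 : vonNeumannEntropy (T ρ.1) -
        t⁻¹ * ∑ k, (X k).trace.re * vonNeumannEntropy (T (τ k).1) ≤ hswCapacity T := by linarith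
    have h5 := mul_le_mul_of_nonneg_left h4 h0.le
    rw [mul_sub, mul_inv_cancel_left₀ h0.ne'] at h5
    rw [h1]
    exact h5

theorem IsPTP.exists_gain [Nonempty A] (hT : IsPTP T) {ε : ℝ} (hε : 0 < ε) :
    ∃ (n : ℕ) (X : Fin n → Matrix A A ℂ), (∀ k, (X k).PosSemidef) ∧ (∑ k, X k).trace = 1 ∧
      hswCapacity T - ε ≤ gain T X := by
  obtain ⟨ρ, hρ⟩ := exists_lt_of_lt_ciSup (f := fun ρ : DensityMatrix A =>
    vonNeumannEntropy (T ρ.1) - convexClosure T ρ.1) (sub_lt_self (hswCapacity T) hε)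
  have h1 : convexClosure T ρ.1 < vonNeumannEntropy (T ρ.1) - (hswCapacity T - ε) := by linarith
  rw [convexClosure] at h1
  obtain ⟨x, ⟨n, p, σ, hp, hp', hσ, rfl⟩, hx⟩ := exists_lt_of_csInf_lt
    (by exact ⟨_, 1, fun _ => 1, fun _ => ρ, fun _ => zero_le_one, by simp, by simp, rfl⟩) h1
  refine ⟨n, fun k => (p k : ℂ) • (σ k).1,
    fun k => (σ k).2.1.smul (Complex.zero_le_real.2 (hp k)), by rw [hσ, ρ.2.2], ?_⟩
  simp only [gain, hσ, hT.homEntropy_smul_state]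
  rw [hT.homEntropy_state]
  linarith

end

/-! ### Superadditivity of the capacity -/

section
variable {A₁ B₁ A₂ B₂ : Type u} [Fintype A₁] [DecidableEq A₁] [Nonempty A₁]
    [Fintype B₁] [DecidableEq B₁] [Fintype A₂] [DecidableEq A₂] [Nonempty A₂]
    [Fintype B₂] [DecidableEq B₂]
    {T₁ : Matrix A₁ A₁ ℂ →ₗ[ℂ] Matrix B₁ B₁ ℂ} {T₂ : Matrix A₂ A₂ ℂ →ₗ[ℂ] Matrix B₂ B₂ ℂ}

/-- The capacity is superadditive: the Holevo quantity of a product ensemble is the sum of the Holevo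
quantities of its factors. -/
theorem hswCapacity_add_le_tensor (h₁ : IsChannel T₁) (h₂ : IsChannel T₂) :
    hswCapacity T₁ + hswCapacity T₂ ≤ hswCapacity (tensor T₁ T₂) := by
  refine le_of_forall_pos_le_add fun ε hε => ?_
  obtain ⟨n, X, hX, hX', hXg⟩ := h₁.isPTP.exists_gain (half_pos hε)
  obtain ⟨m, Y, hY, hY', hYg⟩ := h₂.isPTP.exists_gain (half_pos hε)
  have hk : ∑ k : Fin n × Fin m, X k.1 ⊗ₖ Y k.2 = (∑ k, X k) ⊗ₖ (∑ l, Y l) := by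
    rw [Fintype.sum_prod_type]
    ext ⟨i, j⟩ ⟨i', j'⟩
    simp only [Matrix.sum_apply, kroneckerMap_apply, Finset.sum_mul_sum]
  have h3 := (h₁.isPTP_tensor h₂).gain_le (X := fun k : Fin n × Fin m => X k.1 ⊗ₖ Y k.2)
    fun k => (hX _).kronecker (hY _)
  have hXP := posSemidef_sum Finset.univ fun k _ => hX k
  have hYP := posSemidef_sum Finset.univ fun k _ => hY k
  have tX : ∑ k, (X k).trace.re = 1 := by rw [← Complex.re_sum, ← trace_sum, hX', Complex.one_re]
  have tY : ∑ k, (Y k).trace.re = 1 := by rw [← Complex.re_sum, ← trace_sum, hY', Complex.one_re]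
  have h4 : gain (tensor T₁ T₂) (fun k : Fin n × Fin m => X k.1 ⊗ₖ Y k.2) =
      gain T₁ X + gain T₂ Y := by
    rw [gain, hk]
    simp only [tensor_kronecker]
    rw [homEntropy_kronecker (h₁.isPTP.positive _ hXP) (h₂.isPTP.positive _ hYP)]
    simp only [fun k l => homEntropy_kronecker (h₁.isPTP.positive _ (hX k))
      (h₂.isPTP.positive _ (hY l)), h₁.trace_preserving, h₂.trace_preserving]
    rw [Fintype.sum_prod_type, hX', hY']
    simp only [Finset.sum_add_distrib, ← Finset.sum_mul, ← Finset.mul_sum, tX, tY, gain,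
      Complex.one_re]
    ring
  rw [h4, hk, trace_kronecker, hX', hY', mul_one, Complex.one_re, one_mul] at h3
  linarith

end

/-! ### The Gibbs variational principle -/

section
variable {ι : Type*} [Fintype ι] [Nonempty ι]

theorem eta_add_mul_logb_le {x r : ℝ} (hx : 0 ≤ x) (hr : 0 < r) :
    eta x + x * Real.logb 2 r ≤ (r - x) / Real.log 2 := by
  have h1 := Real.negMulLog_le_one_sub_self (div_nonneg hx hr.le)
  have h2 := Real.negMulLog_mul r (x / r)
  rw [mul_div_cancel₀ _ hr.ne'] at h2
  have h3 : x / r * Real.negMulLog r = -(x * Real.log r) := by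
    rw [Real.negMulLog]; field_simp
  have h4 := mul_le_mul_of_nonneg_left h1 hr.le
  have h5 : r * (1 - x / r) = r - x := by field_simp
  have h6 : eta x + x * Real.logb 2 r = (Real.negMulLog x + x * Real.log r) / Real.log 2 := by
    rw [eta_eq, Real.logb]; ring
  rw [h6]
  exact div_le_div_of_nonneg_right (by linarith) (Real.log_nonneg one_le_two)

theorem sum_rpow_pos (c : ι → ℝ) : 0 < ∑ i, (2 : ℝ) ^ c i :=
  Finset.sum_pos (fun _ _ => by positivity) Finset.univ_nonempty

theorem logb_gibbs (c : ι → ℝ) (i : ι) :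
    Real.logb 2 (2 ^ c i / ∑ j, (2 : ℝ) ^ c j) = c i - Real.logb 2 (∑ j, (2 : ℝ) ^ c j) := by
  rw [Real.logb_div (by positivity) (sum_rpow_pos c).ne', Real.logb_rpow (by norm_num) (by norm_num)]

/-- The Gibbs variational principle. -/
theorem gibbs_le {q : ι → ℝ} (hq : ∀ i, 0 ≤ q i) (hq' : ∑ i, q i = 1) (c : ι → ℝ) :
    ∑ i, q i * c i + ∑ i, eta (q i) ≤ Real.logb 2 (∑ i, (2 : ℝ) ^ c i) := by
  have hZ := sum_rpow_pos c
  set Z := ∑ i, (2 : ℝ) ^ c i with hZd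
  have h1 : ∀ i, eta (q i) + q i * (c i - Real.logb 2 Z) ≤
      (2 ^ c i / Z - q i) / Real.log 2 := fun i => by
    rw [← logb_gibbs]
    exact eta_add_mul_logb_le (hq i) (by positivity)
  have h2 := Finset.sum_le_sum fun i (_ : i ∈ Finset.univ) => h1 i
  rw [← Finset.sum_div, Finset.sum_sub_distrib, ← Finset.sum_div, ← hZd, div_self hZ.ne', hq',
    sub_self, zero_div] at h2
  simp only [mul_sub, Finset.sum_add_distrib, Finset.sum_sub_distrib, ← Finset.sum_mul, hq'] at h2
  linarith

/-- The Gibbs weights `2 ^ c i / ∑ j, 2 ^ c j` attain the bound in `gibbs_le`. -/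
theorem exists_gibbs_eq (c : ι → ℝ) : ∃ q : ι → ℝ, (∀ i, 0 ≤ q i) ∧ ∑ i, q i = 1 ∧
    ∑ i, q i * c i + ∑ i, eta (q i) = Real.logb 2 (∑ i, (2 : ℝ) ^ c i) := by
  have hZ := sum_rpow_pos c
  have h1 : ∑ i, (2 : ℝ) ^ c i / ∑ j, (2 : ℝ) ^ c j = 1 := by
    rw [← Finset.sum_div, div_self hZ.ne']
  refine ⟨fun i => 2 ^ c i / ∑ j, (2 : ℝ) ^ c j, fun i => by positivity, h1, ?_⟩
  rw [← Finset.sum_add_distrib]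
  simp only [eta, logb_gibbs]
  have h2 : ∀ i, (2 : ℝ) ^ c i / (∑ j, (2 : ℝ) ^ c j) * c i +
      -(2 ^ c i / (∑ j, (2 : ℝ) ^ c j) * (c i - Real.logb 2 (∑ j, (2 : ℝ) ^ c j))) =
      2 ^ c i / (∑ j, (2 : ℝ) ^ c j) * Real.logb 2 (∑ j, (2 : ℝ) ^ c j) := fun i => by ring
  rw [Finset.sum_congr rfl fun i _ => h2 i, ← Finset.sum_mul, h1, one_mul]

end

/-! ### The capacity of a direct sum -/

namespace IsDirectSum

variable {ι : Type*} [Fintype ι] [DecidableEq ι] {A B : Type u} {A' B' : ι → Type u}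
    [Fintype A] [DecidableEq A] [Fintype B] [DecidableEq B]
    [∀ i, Fintype (A' i)] [∀ i, DecidableEq (A' i)]
    [∀ i, Fintype (B' i)] [∀ i, DecidableEq (B' i)]
    {T : Matrix A A ℂ →ₗ[ℂ] Matrix B B ℂ}
    {S : ∀ i, Matrix (A' i) (A' i) ℂ →ₗ[ℂ] Matrix (B' i) (B' i) ℂ}
    {V : ∀ i, Matrix A (A' i) ℂ} {W : ∀ i, Matrix B (B' i) ℂ}

theorem homEntropy_apply (h : IsDirectSum T S V W) (hT : IsPTP T) (hS : ∀ i, IsPTP (S i))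
    {X : Matrix A A ℂ} (hX : X.PosSemidef) :
    homEntropy (T X) = ∑ i, homEntropy (S i (conjLin (V i)ᴴ X)) +
      ∑ i, eta (conjLin (V i)ᴴ X).trace.re - eta X.trace.re := by
  rw [homEntropy, hT.trace_preserving, h.apply_eq, vonNeumannEntropy_sum h.isometry_out
    h.orthogonal_out fun i => ((hS i).positive _ (posSemidef_conjLin _ hX)).isHermitian]
  simp only [homEntropy, (hS _).trace_preserving, Finset.sum_sub_distrib]
  ring

variable [Nonempty A] [∀ i, Nonempty (A' i)]

/-- One half of `2 ^ χ(⨁ i, S i) = ∑ i, 2 ^ χ(S i)`: cut an ensemble for the direct sum into its diagonal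
blocks. -/
theorem hswCapacity_le [Nonempty ι] (h : IsDirectSum T S V W) (hT : IsPTP T)
    (hS : ∀ i, IsPTP (S i)) :
    hswCapacity T ≤ Real.logb 2 (∑ i, (2 : ℝ) ^ hswCapacity (S i)) := by
  refine le_of_forall_pos_le_add fun ε hε => ?_
  obtain ⟨n, X, hX, hX', hXg⟩ := hT.exists_gain hε
  have hXP := posSemidef_sum Finset.univ fun k _ => hX k
  set q : ι → ℝ := fun i => (conjLin (V i)ᴴ (∑ k, X k)).trace.re with hq
  have hq0 : ∀ i, 0 ≤ q i := fun i => trace_re_nonneg (posSemidef_conjLin _ hXP)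
  have hq1 : ∑ i, q i = 1 := by
    rw [hq, ← Complex.re_sum, h.sum_trace, hX', Complex.one_re]
  have h1 : ∀ i, gain (S i) (fun k => conjLin (V i)ᴴ (X k)) ≤ q i * hswCapacity (S i) :=
    fun i => by
      have h2 := (hS i).gain_le fun k => posSemidef_conjLin (V i)ᴴ (hX k)
      rwa [← map_sum] at h2
  have h2 : ∀ k, ∑ i, homEntropy (S i (conjLin (V i)ᴴ (X k))) ≤ homEntropy (T (X k)) := fun k => by
    rw [h.homEntropy_apply hT hS (hX k)]
    have ht0 : ∀ i, 0 ≤ (conjLin (V i)ᴴ (X k)).trace.re := fun i =>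
      trace_re_nonneg (posSemidef_conjLin _ (hX k))
    have ht : ∑ i, (conjLin (V i)ᴴ (X k)).trace.re = (X k).trace.re := by
      rw [← Complex.re_sum, h.sum_trace]
    -- `η` is subadditive, so the classical information in the block index only helps.
    have h3 : eta (X k).trace.re ≤ ∑ i, eta (conjLin (V i)ᴴ (X k)).trace.re := by
      rw [← ht]
      simp only [eta, Finset.sum_neg_distrib, Finset.sum_mul]
      refine neg_le_neg (Finset.sum_le_sum fun i _ => ?_)
      rcases (ht0 i).eq_or_lt with h0 | h0
      · rw [← h0]; simp
      · exact mul_le_mul_of_nonneg_left (Real.logb_le_logb_of_le one_lt_two h0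
          (Finset.single_le_sum (fun j _ => ht0 j) (Finset.mem_univ i))) h0.le
    linarith
  have h3 : gain T X ≤ ∑ i, gain (S i) (fun k => conjLin (V i)ᴴ (X k)) + ∑ i, eta (q i) := by
    have h4 := Finset.sum_le_sum fun k (_ : k ∈ Finset.univ) => h2 k
    rw [gain, h.homEntropy_apply hT hS hXP, hX', Complex.one_re, eta_one]
    simp only [gain, Finset.sum_sub_distrib, ← map_sum]
    rw [Finset.sum_comm] at h4
    linarith
  have h4 := Finset.sum_le_sum fun i (_ : i ∈ Finset.univ) => h1 i
  have h5 := gibbs_le hq0 hq1 fun i => hswCapacity (S i)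
  linarith

/-- The other half of `2 ^ χ(⨁ i, S i) = ∑ i, 2 ^ χ(S i)`: mix good ensembles for the summands with the
Gibbs weights. -/
theorem le_hswCapacity [Nonempty ι] (h : IsDirectSum T S V W) (hT : IsPTP T)
    (hS : ∀ i, IsPTP (S i)) :
    Real.logb 2 (∑ i, (2 : ℝ) ^ hswCapacity (S i)) ≤ hswCapacity T := by
  refine le_of_forall_pos_le_add fun ε hε => ?_
  obtain ⟨q, hq0, hq1, hq⟩ := exists_gibbs_eq fun i => hswCapacity (S i)
  choose n X hX hX' hXg using fun i => (hS i).exists_gain hε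
  have hXP := fun i => posSemidef_sum Finset.univ fun k _ => hX i k
  let Y : (Σ i, Fin (n i)) → Matrix A A ℂ := fun k => conjLin (V k.1) ((q k.1 : ℂ) • X k.1 k.2)
  have hY : ∀ k, (Y k).PosSemidef := fun k =>
    posSemidef_conjLin _ ((hX _ _).smul (Complex.zero_le_real.2 (hq0 _)))
  have hYs : ∑ k, Y k = ∑ i, conjLin (V i) ((q i : ℂ) • ∑ k, X i k) := by
    rw [Fintype.sum_sigma]
    simp only [Y, Finset.smul_sum, map_sum]
  have hYt : (∑ k, Y k).trace = 1 := by
    rw [hYs, trace_sum]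
    simp only [trace_conjLin (h.isometry_in _), trace_smul, hX', smul_eq_mul, mul_one]
    exact_mod_cast hq1
  have h1 : homEntropy (T (∑ k, Y k)) =
      ∑ i, q i * homEntropy (S i (∑ k, X i k)) + ∑ i, eta (q i) := by
    rw [homEntropy_of_trace_eq_one (by rw [hT.trace_preserving, hYt]), hYs, map_sum]
    simp only [h.apply_conj]
    rw [vonNeumannEntropy_sum h.isometry_out h.orthogonal_out fun i => ((hS i).positive _
      ((hXP i).smul (Complex.zero_le_real.2 (hq0 i)))).isHermitian, ← Finset.sum_add_distrib]
    refine Finset.sum_congr rfl fun i _ => ?_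
    have h2 : (S i (∑ k, X i k)).trace = 1 := by rw [(hS i).trace_preserving, hX']
    rw [map_smul, vonNeumannEntropy_smul ((hS i).positive _ (hXP i)).isHermitian,
      homEntropy_of_trace_eq_one h2, h2, Complex.one_re, mul_one]
  have h2 : gain T Y = ∑ i, q i * gain (S i) (X i) + ∑ i, eta (q i) := by
    have h3 : ∀ i k, homEntropy (T (Y ⟨i, k⟩)) = q i * homEntropy (S i (X i k)) := fun i k => by
      have h4 := ((hS i).positive _ (hX i k)).isHermitian
      rw [h.apply_conj, map_smul, ← homEntropy_smul h4, homEntropy_conjLin _ (h.isometry_out i)]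
      exact (((hS i).positive _ (hX i k)).smul (Complex.zero_le_real.2 (hq0 i))).isHermitian
    rw [gain, h1, Fintype.sum_sigma]
    simp only [h3, gain, mul_sub, Finset.sum_sub_distrib, Finset.mul_sum]
    ring
  have h3 := hT.gain_le hY
  rw [hYt, Complex.one_re, one_mul, h2] at h3
  have h4 : ∑ i, q i * hswCapacity (S i) - ε ≤ ∑ i, q i * gain (S i) (X i) := by
    calc _ = ∑ i, q i * (hswCapacity (S i) - ε) := by
          simp only [mul_sub, Finset.sum_sub_distrib, ← Finset.sum_mul, hq1, one_mul]
      _ ≤ _ := Finset.sum_le_sum fun i _ => mul_le_mul_of_nonneg_left (hXg i) (hq0 i)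
  linarith

end IsDirectSum

/-! ### Additivity of the capacity for the summands -/

section
variable {ι : Type} [Fintype ι] [DecidableEq ι] {A B : ι → Type u}
    [∀ i, Fintype (A i)] [∀ i, DecidableEq (A i)] [∀ i, Nonempty (A i)]
    [∀ i, Fintype (B i)] [∀ i, DecidableEq (B i)]
    {S : ∀ i, Matrix (A i) (A i) ℂ →ₗ[ℂ] Matrix (B i) (B i) ℂ}

/-- Additivity for `(T, T)` with `T = ⨁ i, S i` reads
`∑ i j, 2 ^ χ(S i ⊗ S j) = ∑ i j, 2 ^ (χ(S i) + χ(S j))`, and superadditivity compares the two sides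
term by term. -/
theorem HSWCapacityAdditive.of_directSum (hS : ∀ i, IsChannel (S i))
    (h : HSWCapacityAdditive (directSum S) (directSum S)) (i j : ι) :
    HSWCapacityAdditive (S i) (S j) := by
  have : Nonempty ι := ⟨i⟩
  have : Nonempty (Σ i, A i) := ⟨⟨i, Classical.arbitrary _⟩⟩
  have hd := isDirectSum_directSum S
  have hc := isChannel_directSum hS
  have h1 := hd.hswCapacity_le hc.isPTP fun i => (hS i).isPTP
  have h2 := (hd.tensor hd).le_hswCapacity (hc.isPTP_tensor hc)
    fun k => (hS k.1).isPTP_tensor (hS k.2)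
  rw [h] at h2
  have h3 : Real.logb 2 (∑ k : ι × ι, (2 : ℝ) ^ hswCapacity (tensor (S k.1) (S k.2))) ≤
      Real.logb 2 (∑ k : ι × ι, (2 : ℝ) ^ (hswCapacity (S k.1) + hswCapacity (S k.2))) := by
    have h4 : ∑ k : ι × ι, (2 : ℝ) ^ (hswCapacity (S k.1) + hswCapacity (S k.2)) =
        (∑ i, (2 : ℝ) ^ hswCapacity (S i)) * (∑ i, (2 : ℝ) ^ hswCapacity (S i)) := by
      rw [Fintype.sum_prod_type, Finset.sum_mul_sum]
      simp only [Real.rpow_add two_pos]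
    rw [h4, Real.logb_mul (sum_rpow_pos _).ne' (sum_rpow_pos _).ne']
    linarith
  rw [Real.logb_le_logb one_lt_two (sum_rpow_pos _) (sum_rpow_pos _)] at h3
  have h5 : ∀ k ∈ (Finset.univ : Finset (ι × ι)),
      (2 : ℝ) ^ (hswCapacity (S k.1) + hswCapacity (S k.2)) ≤
      (2 : ℝ) ^ hswCapacity (tensor (S k.1) (S k.2)) := fun k _ =>
    Real.rpow_le_rpow_of_exponent_le one_le_two (hswCapacity_add_le_tensor (hS _) (hS _))
  have h6 := (Finset.sum_eq_sum_iff_of_le h5).1 (le_antisymm (Finset.sum_le_sum h5) h3)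
    (i, j) (Finset.mem_univ _)
  rw [Real.rpow_right_inj two_pos (by norm_num)] at h6
  exact h6.symm

end

/-! ### Minimal output entropy and additional fixed output states -/

section
variable {A B : Type u} [Fintype A] [Fintype B] {T : Matrix A A ℂ →ₗ[ℂ] Matrix B B ℂ}

/-- The map `X ↦ T X ⊗ τ`, which adds the fixed state `τ` to the output of `T`. -/
def kronState {C : Type u} (T : Matrix A A ℂ →ₗ[ℂ] Matrix B B ℂ) (τ : Matrix C C ℂ) :
    Matrix A A ℂ →ₗ[ℂ] Matrix (B × C) (B × C) ℂ where
  toFun X := T X ⊗ₖ τ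
  map_add' X Y := by rw [map_add, add_kronecker]
  map_smul' c X := by rw [map_smul, smul_kronecker]; rfl

theorem isChannel_kronState {C : Type u} [Fintype C] [DecidableEq C] (hT : IsChannel T)
    (τ : DensityMatrix C) : IsChannel (kronState T τ.1) where
  trace_preserving M := by
    simp only [kronState, LinearMap.coe_mk, AddHom.coe_mk, trace_kronecker, τ.2.2, mul_one,
      hT.trace_preserving]
  completelyPositive k M hM := by
    have h := ((hT.completelyPositive k M hM).kronecker τ.2.1).submatrix
      (Equiv.prodAssoc (Fin k) B C).symm
    exact h

end

section
variable {A B : Type u} [Fintype A] [Fintype B] [DecidableEq B]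
  {T : Matrix A A ℂ →ₗ[ℂ] Matrix B B ℂ} {α : ℝ≥0∞}

theorem IsPTP.minOutputEntropy_le (hα : 1 ≤ α) (hT : IsPTP T) (ρ : DensityMatrix A) :
    minOutputEntropy α T ≤ renyiEntropy α (T ρ.1) := by
  refine ciInf_le (f := fun ρ : DensityMatrix A => renyiEntropy α (T ρ.1)) ⟨0, ?_⟩ ρ
  rintro x ⟨σ, rfl⟩
  exact renyiEntropy_nonneg hα (hT.posSemidef_apply σ) (hT.trace_apply σ)

theorem le_minOutputEntropy [DecidableEq A] [Nonempty A] {c : ℝ}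
    (h : ∀ ρ : DensityMatrix A, c ≤ renyiEntropy α (T ρ.1)) : c ≤ minOutputEntropy α T :=
  le_ciInf h

theorem le_minOutputEntropy_kronState [DecidableEq A] [Nonempty A] {C : Type u} [Fintype C]
    [DecidableEq C] (hα : 1 ≤ α) (hT : IsPTP T) (τ : DensityMatrix C) :
    minOutputEntropy α T + renyiEntropy α τ.1 ≤ minOutputEntropy α (kronState T τ.1) :=
  le_minOutputEntropy fun ρ => by
    have h := renyiEntropy_kronecker hα (hT.posSemidef_apply ρ) (hT.trace_apply ρ) τ.2.1 τ.2.2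
    have h' := hT.minOutputEntropy_le hα ρ
    change _ ≤ renyiEntropy α (T ρ.1 ⊗ₖ τ.1)
    change renyiEntropy α (T ρ.1 ⊗ₖ τ.1) = renyiEntropy α (T ρ.1) + _ at h
    linarith

theorem renyiEntropy_submatrix_equiv {C : Type u} [Fintype C] [DecidableEq C] (hα : 1 ≤ α)
    {M : Matrix B B ℂ} (hM : M.IsHermitian) (e : C ≃ B) :
    renyiEntropy α (M.submatrix e e) = renyiEntropy α M := by
  have h1 : M.submatrix e e = conjLin ((1 : Matrix B B ℂ).submatrix e id) M := by
    ext i j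
    simp [conjLin_apply, Matrix.mul_apply, Matrix.one_apply]
  have h2 : ((1 : Matrix B B ℂ).submatrix e id)ᴴ * (1 : Matrix B B ℂ).submatrix e id = 1 := by
    rw [conjTranspose_submatrix, conjTranspose_one, submatrix_mul_equiv, Matrix.one_mul,
      submatrix_id_id]
  rw [h1, renyiEntropy_conjLin hα hM h2]

end

/-! ### Minimal output entropy of direct sums -/

section
variable {ι : Type} [Fintype ι] [DecidableEq ι] {A B : ι → Type u}
    [∀ i, Fintype (A i)] [∀ i, DecidableEq (A i)] [∀ i, Nonempty (A i)]
    [∀ i, Fintype (B i)] [∀ i, DecidableEq (B i)]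
    {S : ∀ i, Matrix (A i) (A i) ℂ →ₗ[ℂ] Matrix (B i) (B i) ℂ} {α : ℝ≥0∞}

theorem le_minOutputEntropy_directSum [Nonempty ι] (hα : 1 ≤ α) (hS : ∀ i, IsChannel (S i)) {c : ℝ}
    (hc : ∀ i, c ≤ minOutputEntropy α (S i)) : c ≤ minOutputEntropy α (directSum S) := by
  have : Nonempty (Σ i, A i) := ⟨⟨Classical.arbitrary ι, Classical.arbitrary _⟩⟩
  refine le_minOutputEntropy fun ρ => ?_
  have h := isDirectSum_directSum S
  have hX := fun i => posSemidef_conjLin (incl A i)ᴴ ρ.2.1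
  choose τ hτ using fun i => exists_state (hX i)
  rw [h.apply_eq]
  have h1 : ∀ i, conjLin (incl B i) (S i (conjLin (incl A i)ᴴ ρ.1)) = conjLin (incl B i)
      (((conjLin (incl A i)ᴴ ρ.1).trace.re : ℂ) • S i (τ i).1) := fun i => by
    rw [← map_smul, ← hτ]
  rw [Finset.sum_congr rfl fun i _ => h1 i]
  refine le_renyiEntropy_sum hα h.isometry_out h.orthogonal_out (fun i => trace_re_nonneg (hX i))
    ?_ (fun i => ((hS i).isPTP.posSemidef_apply (τ i))) (fun i => ((hS i).isPTP.trace_apply (τ i)))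
    fun i => (hc i).trans ((hS i).isPTP.minOutputEntropy_le hα (τ i))
  rw [← Complex.re_sum, h.sum_trace, ρ.2.2, Complex.one_re]

/-- A common lower bound `c` for the minimal output entropies of the summands is inherited by the direct
sum `T`; additivity for `(T, T)` turns it into `2 * c`, which bounds every block of `T ⊗ T`. -/
theorem MinOutputEntropyAdditive.two_mul_le_of_directSum (hα : 1 ≤ α) (hS : ∀ i, IsChannel (S i))
    (h : MinOutputEntropyAdditive α (directSum S) (directSum S)) {c : ℝ}
    (hc : ∀ i, c ≤ minOutputEntropy α (S i)) (i j : ι) :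
    2 * c ≤ minOutputEntropy α (tensor (S i) (S j)) := by
  have : Nonempty ι := ⟨i⟩
  have hd := isDirectSum_directSum S
  have hC := isChannel_directSum hS
  have h1 := le_minOutputEntropy_directSum hα hS hc
  refine le_minOutputEntropy fun ρ => ?_
  have h2 := (hC.isPTP_tensor hC).minOutputEntropy_le hα
    (ρ.conj ((hd.tensor hd).isometry_in (i, j)))
  simp only [DensityMatrix.conj] at h2
  rw [(hd.tensor hd).apply_conj (i, j), renyiEntropy_conjLin hα
    (((hS i).isPTP_tensor (hS j)).positive _ ρ.2.1).isHermitian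
    ((hd.tensor hd).isometry_out (i, j)), h] at h2
  linarith

end

/-! ### Pairs of channels -/

/-- A pair of channels is a family of channels indexed by `Bool`. -/
theorem exists_pair_family (P : ∀ {A₁ B₁ A₂ B₂ : Type u} [Fintype A₁] [DecidableEq A₁]
      [Fintype B₁] [DecidableEq B₁] [Fintype A₂] [DecidableEq A₂] [Fintype B₂] [DecidableEq B₂],
      (Matrix A₁ A₁ ℂ →ₗ[ℂ] Matrix B₁ B₁ ℂ) → (Matrix A₂ A₂ ℂ →ₗ[ℂ] Matrix B₂ B₂ ℂ) → Prop)
    (h : ∀ (A B : Bool → Type u) [∀ i, Fintype (A i)] [∀ i, DecidableEq (A i)]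
      [∀ i, Nonempty (A i)] [∀ i, Fintype (B i)] [∀ i, DecidableEq (B i)]
      (S : ∀ i, Matrix (A i) (A i) ℂ →ₗ[ℂ] Matrix (B i) (B i) ℂ), (∀ i, IsChannel (S i)) →
      P (S true) (S false)) : ForAllPairs.{u} P := by
  intro A₁ B₁ A₂ B₂ _ _ _ _ _ _ _ _ _ _ T₁ T₂ h₁ h₂
  exact @h (fun b => Bool.rec A₂ A₁ b) (fun b => Bool.rec B₂ B₁ b)
    (fun b => by cases b <;> assumption) (fun b => by cases b <;> assumption)
    (fun b => by cases b <;> assumption) (fun b => by cases b <;> assumption)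
    (fun b => by cases b <;> assumption)
    (fun b => Bool.rec T₂ T₁ b)
    (fun b => by cases b <;> assumption)

section
variable {A₁ B₁ A₂ B₂ : Type u} [Fintype A₁] [DecidableEq A₁] [Nonempty A₁]
    [Fintype B₁] [DecidableEq B₁] [Fintype A₂] [DecidableEq A₂] [Nonempty A₂]
    [Fintype B₂] [DecidableEq B₂] {α : ℝ≥0∞}
    {T₁ : Matrix A₁ A₁ ℂ →ₗ[ℂ] Matrix B₁ B₁ ℂ} {T₂ : Matrix A₂ A₂ ℂ →ₗ[ℂ] Matrix B₂ B₂ ℂ}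

theorem minOutputEntropy_tensor_le (hα : 1 ≤ α) (h₁ : IsChannel T₁) (h₂ : IsChannel T₂) :
    minOutputEntropy α (tensor T₁ T₂) ≤ minOutputEntropy α T₁ + minOutputEntropy α T₂ := by
  refine le_ciInf_add_ciInf fun ρ₁ ρ₂ => ?_
  have h := (h₁.isPTP_tensor h₂).minOutputEntropy_le hα (ρ₁.kron ρ₂)
  simp only [DensityMatrix.kron, tensor_kronecker] at h
  rwa [renyiEntropy_kronecker hα (h₁.isPTP.posSemidef_apply ρ₁) (h₁.isPTP.trace_apply ρ₁)
    (h₂.isPTP.posSemidef_apply ρ₂) (h₂.isPTP.trace_apply ρ₂)] at h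

omit [Nonempty A₁] [Nonempty A₂] in
theorem tensor_kronState {C₁ C₂ : Type u} [Fintype C₁] [DecidableEq C₁] [Fintype C₂]
    [DecidableEq C₂] (τ₁ : Matrix C₁ C₁ ℂ) (τ₂ : Matrix C₂ C₂ ℂ)
    (M : Matrix (A₁ × A₂) (A₁ × A₂) ℂ) :
    tensor (kronState T₁ τ₁) (kronState T₂ τ₂) M =
      (tensor T₁ T₂ M ⊗ₖ (τ₁ ⊗ₖ τ₂)).submatrix (Equiv.prodProdProdComm B₁ C₁ B₂ C₂)
        (Equiv.prodProdProdComm B₁ C₁ B₂ C₂) := by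
  induction M using kronecker_induction with
  | add M N hM hN => rw [map_add, hM, hN, map_add, add_kronecker]; rfl
  | kron X Y =>
    rw [tensor_kronecker, tensor_kronecker]
    ext ⟨⟨i, j⟩, ⟨k, l⟩⟩ ⟨⟨i', j'⟩, ⟨k', l'⟩⟩
    simp only [kronState, LinearMap.coe_mk, AddHom.coe_mk, kroneckerMap_apply, submatrix_apply,
      Equiv.prodProdProdComm_apply]
    ring

theorem minOutputEntropy_tensor_kronState_le {C₁ C₂ : Type u} [Fintype C₁] [DecidableEq C₁]
    [Fintype C₂] [DecidableEq C₂] (hα : 1 ≤ α) (h₁ : IsChannel T₁) (h₂ : IsChannel T₂)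
    (τ₁ : DensityMatrix C₁) (τ₂ : DensityMatrix C₂) :
    minOutputEntropy α (tensor (kronState T₁ τ₁.1) (kronState T₂ τ₂.1)) ≤
      minOutputEntropy α (tensor T₁ T₂) + (renyiEntropy α τ₁.1 + renyiEntropy α τ₂.1) := by
  rw [← sub_le_iff_le_add]
  refine le_minOutputEntropy fun ρ => ?_
  have hT := h₁.isPTP_tensor h₂
  have h := ((isChannel_kronState h₁ τ₁).isPTP_tensor
    (isChannel_kronState h₂ τ₂)).minOutputEntropy_le hα ρ
  have hk : (τ₁.1 ⊗ₖ τ₂.1).PosSemidef := (τ₁.kron τ₂).2.1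
  have hk' : (τ₁.1 ⊗ₖ τ₂.1).trace = 1 := (τ₁.kron τ₂).2.2
  rw [tensor_kronState, renyiEntropy_submatrix_equiv hα
      ((hT.posSemidef_apply ρ).kronecker hk).isHermitian,
    renyiEntropy_kronecker hα (hT.posSemidef_apply ρ) (hT.trace_apply ρ) hk hk',
    renyiEntropy_kronecker hα τ₁.2.1 τ₁.2.2 τ₂.2.1 τ₂.2.2] at h
  linarith

/-- The direct sum only sees the smaller of the two minimal output entropies, so both are first raised to
(almost) the common value `s₁ + s₂`, by adding to the output of each channel a nearly optimal output
state of the other one. -/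
theorem MinOutputEntropyAdditive.of_forall_equal (hα : 1 ≤ α)
    (h : ForAllEqualPairs.{u} (MinOutputEntropyAdditive α)) (h₁ : IsChannel T₁)
    (h₂ : IsChannel T₂) : MinOutputEntropyAdditive α T₁ T₂ := by
  refine le_antisymm (minOutputEntropy_tensor_le hα h₁ h₂) (le_of_forall_pos_le_add fun ε hε => ?_)
  obtain ⟨ρ₁, hρ₁⟩ := exists_lt_of_ciInf_lt (f := fun ρ : DensityMatrix A₁ =>
    renyiEntropy α (T₁ ρ.1)) (lt_add_of_pos_right (minOutputEntropy α T₁) (half_pos hε))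
  obtain ⟨ρ₂, hρ₂⟩ := exists_lt_of_ciInf_lt (f := fun ρ : DensityMatrix A₂ =>
    renyiEntropy α (T₂ ρ.1)) (lt_add_of_pos_right (minOutputEntropy α T₂) (half_pos hε))
  have key : ForAllPairs.{u} (fun {A₁ B₁ A₂ B₂} _ _ _ _ _ _ _ _ S₁ S₂ => ∀ c,
      c ≤ minOutputEntropy α S₁ → c ≤ minOutputEntropy α S₂ →
      2 * c ≤ minOutputEntropy α (tensor S₁ S₂)) := by
    refine exists_pair_family _ fun A B _ _ _ _ _ S hS c hc₁ hc₂ => ?_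
    have : Nonempty (Σ i, A i) := ⟨⟨true, Classical.arbitrary _⟩⟩
    exact (h _ _ _ (isChannel_directSum hS)).two_mul_le_of_directSum hα hS
      (fun b => by cases b <;> assumption) true false
  set τ₁ := h₁.isPTP.mapState ρ₁
  set τ₂ := h₂.isPTP.mapState ρ₂
  have h3 := key _ _ _ _ _ _ (isChannel_kronState h₁ τ₂) (isChannel_kronState h₂ τ₁)
    (minOutputEntropy α T₁ + minOutputEntropy α T₂)
    (le_trans (by gcongr; exact h₂.isPTP.minOutputEntropy_le hα ρ₂)
      (le_minOutputEntropy_kronState hα h₁.isPTP τ₂))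
    (le_trans (by rw [add_comm]; gcongr; exact h₁.isPTP.minOutputEntropy_le hα ρ₁)
      (le_minOutputEntropy_kronState hα h₂.isPTP τ₁))
  have h4 := minOutputEntropy_tensor_kronState_le hα h₁ h₂ τ₂ τ₁
  change renyiEntropy α τ₁.1 < _ at hρ₁
  change renyiEntropy α τ₂.1 < _ at hρ₂
  linarith

end

theorem ForAllPairs.forAllEqualPairs {P : ∀ {A₁ B₁ A₂ B₂ : Type u} [Fintype A₁] [DecidableEq A₁]
      [Fintype B₁] [DecidableEq B₁] [Fintype A₂] [DecidableEq A₂] [Fintype B₂] [DecidableEq B₂],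
      (Matrix A₁ A₁ ℂ →ₗ[ℂ] Matrix B₁ B₁ ℂ) → (Matrix A₂ A₂ ℂ →ₗ[ℂ] Matrix B₂ B₂ ℂ) → Prop}
    (h : ForAllPairs.{u} P) : ForAllEqualPairs.{u} P :=
  fun A B _ _ _ _ _ T hT => h A B A B T T hT hT

end QChannel

theorem proposition2 :
    (∀ α : ℝ≥0∞, 1 ≤ α →
      (QChannel.ForAllPairs.{u} (QChannel.MinOutputEntropyAdditive α) ↔
        QChannel.ForAllEqualPairs.{u} (QChannel.MinOutputEntropyAdditive α))) ∧
    (QChannel.ForAllPairs.{u} QChannel.HSWCapacityAdditive ↔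
      QChannel.ForAllEqualPairs.{u} QChannel.HSWCapacityAdditive) ∧
    (QChannel.ForAllPairs.{u} QChannel.ConvexClosureStronglySuperadditive ↔
      QChannel.ForAllEqualPairs.{u} QChannel.ConvexClosureStronglySuperadditive) ∧
    (QChannel.ForAllPairs.{u} QChannel.ConvexClosureAdditiveOnProducts ↔
      QChannel.ForAllEqualPairs.{u} QChannel.ConvexClosureAdditiveOnProducts) := by
  refine ⟨fun α hα => ⟨fun h => h.forAllEqualPairs, fun h => ?_⟩,
    ⟨fun h => h.forAllEqualPairs, fun h => ?_⟩, ⟨fun h => h.forAllEqualPairs, fun h => ?_⟩,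
    ⟨fun h => h.forAllEqualPairs, fun h => ?_⟩⟩
  · intro A₁ B₁ A₂ B₂ _ _ _ _ _ _ _ _ _ _ T₁ T₂ h₁ h₂
    exact QChannel.MinOutputEntropyAdditive.of_forall_equal hα h h₁ h₂
  · refine QChannel.exists_pair_family _ fun A B _ _ _ _ _ S hS => ?_
    have : Nonempty (Σ i, A i) := ⟨⟨true, Classical.arbitrary _⟩⟩
    exact (h _ _ _ (QChannel.isChannel_directSum hS)).of_directSum hS true false
  · refine QChannel.exists_pair_family _ fun A B _ _ _ _ _ S hS => ?_
    have : Nonempty (Σ i, A i) := ⟨⟨true, Classical.arbitrary _⟩⟩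
    exact (h _ _ _ (QChannel.isChannel_directSum hS)).of_directSum hS true false
  · refine QChannel.exists_pair_family _ fun A B _ _ _ _ _ S hS => ?_
    have : Nonempty (Σ i, A i) := ⟨⟨true, Classical.arbitrary _⟩⟩
    exact (h _ _ _ (QChannel.isChannel_directSum hS)).of_directSum hS true false
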